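/- Let $p,q\in\mathbb C$ with $0<|p|<1$ and $0<|q|<1$. Put $$(z;q)_\infty=\prod_{j=0}^\infty(1-zq^j),\qquad (z;p,q)_\infty=\prod_{j,k=0}^\infty(1-zp^jq^k),$$ and let $$\Gamma(z;p,q)=\frac{(pqz^{-1};p,q)_\infty}{(z;p,q)_\infty}\qquad(z\in\mathbb C\setminus\{0\})$$ be the elliptic gamma function, with the notation $\Gamma(tz^{\pm1};p,q)=\Gamma(tz;p,q)\Gamma(tz^{-1};p,q)$ and $\Gamma(z^{\pm2};p,q)=\Gamma(z^2;p,q)\Gamma(z^{-2};p,q)$. Let $t_1,\dots,t_6\in\mathbb C$ satisfy $|t_j|<1$ for all $j$ and the balancing condition $\prod_{j=1}^6t_j=pq$. Then the integral below converges and $$\kappa\int_{\mathbb T}\frac{\prod_{j=1}^6\Gamma(t_jz^{\pm1};p,q)}{\Gamma(z^{\pm2};p,q)}\frac{dz}{z}=\prod_{1\le j<k\le6}\Gamma(t_jt_k;p,q),\qquad \kappa=\frac{(p;p)_\infty(q;q)_\infty}{4\pi i},$$ where $\mathbb T$ is the positively oriented unit circle (at $z=\pm1$, where $\Gamma(z^{\pm2};p,q)$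 has a pole, the integrand is understood to be $0$, which is its limit). -/

import Mathlib

/-- The infinite product `(z; q)_∞ = ∏_{j ≥ 0} (1 - z q^j)`, for `|q| < 1`. -/
noncomputable def qPochInf (z q : ℂ) : ℂ :=
  ∏' j : ℕ, (1 - z * q ^ j)

/-- The double infinite product `(z; p, q)_∞ = ∏_{j, k ≥ 0} (1 - z p^j q^k)`,
for `|p|, |q| < 1`. -/
noncomputable def pqPochInf (z p q : ℂ) : ℂ :=
  ∏' jk : ℕ × ℕ, (1 - z * p ^ jk.1 * q ^ jk.2)

/-- The product defining `(z; q)_∞` converges unconditionally, so that `∏'` is its value. -/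
theorem multipliable_qPochInf (z : ℂ) {q : ℂ} (hq : ‖q‖ < 1) :
    Multipliable fun j : ℕ => (1 - z * q ^ j) := by
  have h : Summable fun j : ℕ => ‖-(z * q ^ j)‖ := by
    simpa [norm_mul, norm_pow] using
      (summable_geometric_of_lt_one (norm_nonneg q) hq).mul_left ‖z‖
  simpa [sub_eq_add_neg] using multipliable_one_add_of_summable h

/-- The product defining `(z; p, q)_∞` converges unconditionally, so that `∏'` is its value. -/
theorem multipliable_pqPochInf (z : ℂ) {p q : ℂ} (hp : ‖p‖ < 1) (hq : ‖q‖ < 1) :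
    Multipliable fun jk : ℕ × ℕ => (1 - z * p ^ jk.1 * q ^ jk.2) := by
  have h0 : Summable fun jk : ℕ × ℕ => ‖p‖ ^ jk.1 * ‖q‖ ^ jk.2 :=
    (summable_geometric_of_lt_one (norm_nonneg p) hp).mul_of_nonneg
      (summable_geometric_of_lt_one (norm_nonneg q) hq)
      (fun _ => by positivity) (fun _ => by positivity)
  have h : Summable fun jk : ℕ × ℕ => ‖-(z * p ^ jk.1 * q ^ jk.2)‖ := by
    simpa [norm_mul, norm_pow, mul_assoc] using h0.mul_left ‖z‖
  simpa [sub_eq_add_neg] using multipliable_one_add_of_summable h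

/-- The elliptic gamma function `Γ(z; p, q) = (p q z⁻¹; p, q)_∞ / (z; p, q)_∞`,
for `|p|, |q| < 1` and `z ≠ 0`. (At the poles `z = p^{-j} q^{-k}` the value is `0`.) -/
noncomputable def ellipticGamma (z p q : ℂ) : ℂ :=
  pqPochInf (p * q * z⁻¹) p q / pqPochInf z p q

/-- The normalizing constant `κ = (p; p)_∞ (q; q)_∞ / (4 π i)`. -/
noncomputable def ellipticBetaKappa (p q : ℂ) : ℂ :=
  qPochInf p p * qPochInf q q / (4 * (Real.pi : ℂ) * Complex.I)

/-- The function `∏_{j=1}^6 Γ(t_j z; p, q) Γ(t_j z⁻¹; p, q) / (Γ(z²; p, q) Γ(z⁻²; p, q))`.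
On the unit circle the arguments of `ellipticGamma` are poles only at `z = ±1`, in the
denominator; there the value of the code is `0`, which is also the limit of the function. -/
noncomputable def ellipticBetaDensity (t : Fin 6 → ℂ) (p q z : ℂ) : ℂ :=
  (∏ j : Fin 6, ellipticGamma (t j * z) p q * ellipticGamma (t j * z⁻¹) p q) /
    (ellipticGamma (z ^ 2) p q * ellipticGamma ((z ^ 2)⁻¹) p q)

open Filter Topology Complex

/-! Divide the integral by the product of gamma functions. The quotient `ellipticBetaRatio` does not
depend on the parameters, and its constant value is found in a degenerate limit.

Independence. Suppose ∏ x_j = p. By a theta function identity (`qTheta_six_parameter`, a consequence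
of Weierstrass' three-term identity), the integrands with x_0, respectively x_1, multiplied by q
differ, after weighting by theta factors, by a multiple of F(z) - F(qz), where F is holomorphic on
|q| ≤ |z| ≤ 1. Shifting the contour makes this difference integrate to 0 against dz/z. The gamma
product obeys the same relation, so the ratio is unchanged when a factor q moves from one parameter
to another (`ellipticBetaRatio_base_shift`). Now fix the product k = xy of two parameters. The ratio
is holomorphic in x on |k| < |x| < 1 and invariant under x ↦ qx. If |k| < |q| the annulus is wider
than one period, and the maximum principle makes the ratio constant. The remaining k are reached by
analytic continuation in the other parameters (`ellipticBetaRatio_eq_of_pair`). Only q-shifts occur,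
so p and q need not be multiplicatively independent.

Evaluation. Two pairs of parameters are replaced by (τ, A/τ) and (τ, B/τ). As τ → 1 from below, the
double poles at τ and 1/τ pinch the unit circle at z = 1. After multiplication by 1 - τ², the
singular part of the integrand is an approximate identity with integral 4πi against dz/z
(`tendsto_circleIntegral_betaKernel`). In the product only Γ(τ²) is singular
(`tendsto_one_sub_sq_mul_ellipticBetaProduct`). The quotient of the two limits is 1/κ. -/

/-! ### Infinite products: nonvanishing, functional equations, holomorphy. -/

theorem qPochInf_ne_zero {z q : ℂ} (hq : ‖q‖ < 1) (hz : ‖z‖ < 1) : qPochInf z q ≠ 0 := by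
  have h : Summable fun j : ℕ => ‖-(z * q ^ j)‖ := by
    simpa [norm_mul, norm_pow] using
      (summable_geometric_of_lt_one (norm_nonneg q) hq).mul_left ‖z‖
  have := tprod_one_add_ne_zero_of_summable (f := fun j : ℕ => -(z * q ^ j)) (fun j hj => ?_) h
  · simpa [qPochInf, sub_eq_add_neg] using this
  · have h1 : z * q ^ j = 1 := by linear_combination -hj
    have h2 : ‖z * q ^ j‖ < 1 := by
      rw [norm_mul, norm_pow]
      calc ‖z‖ * ‖q‖ ^ j ≤ ‖z‖ * 1 := by
            gcongr; exact pow_le_one₀ (norm_nonneg _) hq.le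
        _ < 1 := by simpa using hz
    rw [h1] at h2; simp at h2

theorem pqPochInf_comm (z p q : ℂ) : pqPochInf z p q = pqPochInf z q p := by
  unfold pqPochInf
  rw [← (Equiv.prodComm ℕ ℕ).tprod_eq]
  refine tprod_congr fun jk => ?_
  simp [mul_assoc, mul_comm (p ^ _)]

theorem qPochInf_eq_mul (z : ℂ) {q : ℂ} (hq : ‖q‖ < 1) :
    qPochInf z q = (1 - z) * qPochInf (q * z) q := by
  unfold qPochInf
  have h := multipliable_qPochInf (q * z) hq
  rw [tprod_eq_zero_mul' (f := fun j : ℕ => 1 - z * q ^ j)]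
  · simp only [pow_zero, mul_one]
    congr 1
    exact tprod_congr fun j => by ring
  · exact h.congr fun j => by ring

theorem hasProd_qPochInf_pqPochInf (z : ℂ) {p q : ℂ} (hp : ‖p‖ < 1) (hq : ‖q‖ < 1) :
    HasProd (fun k : ℕ => qPochInf (z * q ^ k) p) (pqPochInf z p q) := by
  -- The bases are exchanged so that the outer index of the iterated product is the exponent of q.
  have h := (multipliable_pqPochInf z hq hp).hasProd
  have h2 := h.prod_fiberwise (g := fun k : ℕ => qPochInf (z * q ^ k) p) (fun k => by
    exact (multipliable_qPochInf (z * q ^ k) hp).hasProd)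
  rw [pqPochInf_comm]
  exact h2

theorem pqPochInf_eq_mul (z : ℂ) {p q : ℂ} (hp : ‖p‖ < 1) (hq : ‖q‖ < 1) :
    pqPochInf z p q = qPochInf z p * pqPochInf (q * z) p q := by
  have h := hasProd_qPochInf_pqPochInf z hp hq
  have h2 := hasProd_qPochInf_pqPochInf (q * z) hp hq
  rw [← h.tprod_eq, ← h2.tprod_eq, tprod_eq_zero_mul' (f := fun k : ℕ => qPochInf (z * q ^ k) p)]
  · simp only [pow_zero, mul_one]
    congr 1
    exact tprod_congr fun j => by ring_nf
  · exact h2.multipliable.congr fun j => by ring_nf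

theorem pqPochInf_eq_mul' (z : ℂ) {p q : ℂ} (hp : ‖p‖ < 1) (hq : ‖q‖ < 1) :
    pqPochInf z p q = qPochInf z q * pqPochInf (p * z) p q := by
  rw [pqPochInf_comm, pqPochInf_eq_mul z hq hp, pqPochInf_comm]

theorem pqPochInf_ne_zero {z p q : ℂ} (hp : ‖p‖ < 1) (hq : ‖q‖ < 1) (hz : ‖z‖ < 1) :
    pqPochInf z p q ≠ 0 := by
  have h0 : Summable fun jk : ℕ × ℕ => ‖p‖ ^ jk.1 * ‖q‖ ^ jk.2 :=
    (summable_geometric_of_lt_one (norm_nonneg p) hp).mul_of_nonneg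
      (summable_geometric_of_lt_one (norm_nonneg q) hq)
      (fun _ => by positivity) (fun _ => by positivity)
  have h : Summable fun jk : ℕ × ℕ => ‖-(z * p ^ jk.1 * q ^ jk.2)‖ := by
    simpa [norm_mul, norm_pow, mul_assoc] using h0.mul_left ‖z‖
  have := tprod_one_add_ne_zero_of_summable
    (f := fun jk : ℕ × ℕ => -(z * p ^ jk.1 * q ^ jk.2)) (fun j hj => ?_) h
  · simpa [pqPochInf, sub_eq_add_neg] using this
  · have h1 : z * p ^ j.1 * q ^ j.2 = 1 := by linear_combination -hj
    have h2 : ‖z * p ^ j.1 * q ^ j.2‖ < 1 := by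
      rw [norm_mul, norm_mul, norm_pow, norm_pow]
      calc ‖z‖ * ‖p‖ ^ j.1 * ‖q‖ ^ j.2 ≤ ‖z‖ * 1 * 1 := by
            gcongr
            · exact pow_le_one₀ (norm_nonneg _) hp.le
            · exact pow_le_one₀ (norm_nonneg _) hq.le
        _ < 1 := by simpa using hz
    rw [h1] at h2; simp at h2

/-- On a ball of radius ‖z₀‖ + 1 the terms are dominated by (‖z₀‖ + 1)‖a i‖, so the product
converges locally uniformly there. -/
theorem differentiable_tprod_one_sub_mul {ι : Type*} {a : ι → ℂ} (ha : Summable fun i => ‖a i‖) :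
    Differentiable ℂ fun z : ℂ => ∏' i, (1 - z * a i) := by
  intro z₀
  have hb : Metric.ball (0 : ℂ) (‖z₀‖ + 1) ∈ 𝓝 z₀ :=
    Metric.isOpen_ball.mem_nhds (by simp)
  have hP : HasProdLocallyUniformlyOn (fun i (z : ℂ) => 1 + -(z * a i))
      (fun z => ∏' i, (1 + -(z * a i))) (Metric.ball (0 : ℂ) (‖z₀‖ + 1)) := by
    refine Summable.hasProdLocallyUniformlyOn_one_add Metric.isOpen_ball
      (ha.mul_left (‖z₀‖ + 1)) (.of_forall fun i z hz => ?_) fun i => by fun_prop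
    rw [norm_neg, norm_mul]
    gcongr
    simpa using (mem_ball_zero_iff.1 hz).le
  have := hP.differentiableOn (.of_forall fun s => ?_) Metric.isOpen_ball
  · simpa [sub_eq_add_neg] using this.differentiableAt hb
  · exact DifferentiableOn.fun_finsetProd fun i _ => by fun_prop

theorem differentiable_qPochInf {q : ℂ} (hq : ‖q‖ < 1) :
    Differentiable ℂ fun z => qPochInf z q :=
  differentiable_tprod_one_sub_mul (a := fun j : ℕ => q ^ j) (by
    simpa using summable_geometric_of_lt_one (norm_nonneg q) hq)

theorem differentiable_pqPochInf {p q : ℂ} (hp : ‖p‖ < 1) (hq : ‖q‖ < 1) :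
    Differentiable ℂ fun z => pqPochInf z p q := by
  have h0 : Summable fun jk : ℕ × ℕ => ‖p‖ ^ jk.1 * ‖q‖ ^ jk.2 :=
    (summable_geometric_of_lt_one (norm_nonneg p) hp).mul_of_nonneg
      (summable_geometric_of_lt_one (norm_nonneg q) hq)
      (fun _ => by positivity) (fun _ => by positivity)
  have := differentiable_tprod_one_sub_mul (a := fun jk : ℕ × ℕ => p ^ jk.1 * q ^ jk.2) (by
    simpa using h0)
  simpa [pqPochInf, mul_assoc] using this

/-! ### The theta function. -/

/-- The modified theta function `θ(z; p) = (z; p)_∞ (p / z; p)_∞`. -/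
noncomputable def qTheta (z p : ℂ) : ℂ :=
  qPochInf z p * qPochInf (p / z) p

theorem qTheta_mul_base {z p : ℂ} (hz : z ≠ 0) (hp0 : p ≠ 0) (hp : ‖p‖ < 1) :
    qTheta (p * z) p = -qTheta z p / z := by
  unfold qTheta
  have h1 := qPochInf_eq_mul z hp
  have h2 := qPochInf_eq_mul z⁻¹ hp
  have h3 : p / (p * z) = z⁻¹ := by field_simp
  rw [h3, h1, h2, div_eq_mul_inv p z]
  field_simp
  ring

theorem qTheta_inv {z p : ℂ} (hz : z ≠ 0) (hp0 : p ≠ 0) (hp : ‖p‖ < 1) :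
    qTheta z⁻¹ p = -qTheta z p / z := by
  rw [← qTheta_mul_base hz hp0 hp, qTheta, qTheta, div_inv_eq_mul, mul_comm]
  congr 2
  field_simp

theorem qTheta_base_div {z p : ℂ} (hp0 : p ≠ 0) :
    qTheta (p / z) p = qTheta z p := by
  unfold qTheta
  rw [mul_comm]
  congr 2
  field_simp

theorem qTheta_one {p : ℂ} (hp : ‖p‖ < 1) : qTheta 1 p = 0 := by
  rw [qTheta, qPochInf_eq_mul 1 hp]; simp

theorem qTheta_ne_zero {z p : ℂ} (hp : ‖p‖ < 1) (h1 : ‖p‖ < ‖z‖) (h2 : ‖z‖ < 1) :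
    qTheta z p ≠ 0 := by
  have hz : 0 < ‖z‖ := (norm_nonneg p).trans_lt h1
  refine mul_ne_zero (qPochInf_ne_zero hp h2) (qPochInf_ne_zero hp ?_)
  rwa [norm_div, div_lt_one hz]

theorem differentiableAt_qTheta {z p : ℂ} (hz : z ≠ 0) (hp : ‖p‖ < 1) :
    DifferentiableAt ℂ (fun z => qTheta z p) z := by
  unfold qTheta
  have h := differentiable_qPochInf hp
  exact (h z).mul ((h _).comp z (by fun_prop (disch := assumption)))

/-! ### Contour shifts and Laurent coefficients. -/

/-- The mean of `F` over the circle `|z| = ‖q‖` as a mean over the unit circle. -/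
theorem circleIntegral_inv_mul_comp_mul (F : ℂ → ℂ) (q : ℂ) (hq0 : q ≠ 0) :
    (∮ z in C(0, 1), z⁻¹ * F (q * z)) = ∮ z in C(0, ‖q‖), z⁻¹ * F z := by
  have key : ∀ (R : ℝ), R ≠ 0 → ∀ G : ℂ → ℂ, (∮ z in C(0, R), z⁻¹ * G z) =
      ∫ θ in (0 : ℝ)..2 * Real.pi, I * G (circleMap 0 R θ) := by
    intro R hR G
    unfold circleIntegral
    refine intervalIntegral.integral_congr fun θ _ => ?_
    have : circleMap 0 R θ ≠ 0 := circleMap_ne_center hR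
    simp only [deriv_circleMap, smul_eq_mul]
    field_simp
  rw [key 1 one_ne_zero, key ‖q‖ (norm_ne_zero_iff.2 hq0)]
  have hper : Function.Periodic (fun θ : ℝ => I * F (circleMap 0 ‖q‖ θ)) (2 * Real.pi) := by
    intro θ
    simp only [periodic_circleMap 0 ‖q‖ θ]
  have h1 : ∀ θ : ℝ, I * F (q * circleMap 0 1 θ) = I * F (circleMap 0 ‖q‖ (θ + arg q)) := by
    intro θ
    congr 2
    conv_lhs => rw [← norm_mul_exp_arg_mul_I q]
    simp only [circleMap, zero_add, ofReal_one, one_mul, ofReal_add, add_mul, Complex.exp_add]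
    ring
  simp only [h1]
  rw [intervalIntegral.integral_comp_add_right (fun θ : ℝ => I * F (circleMap 0 ‖q‖ θ)),
    zero_add, add_comm (2 * Real.pi)]
  exact (hper.intervalIntegral_add_eq (arg q) 0).trans (by rw [zero_add])

/-- Since dz/z is invariant under dilation, the left side is the integral over |z| = ‖q‖, and
Cauchy's theorem on the annulus moves that circle to |z| = 1. -/
theorem circleIntegral_inv_mul_comp_mul_eq {F : ℂ → ℂ} {q : ℂ} (hq0 : q ≠ 0) (hq : ‖q‖ ≤ 1)
    (hF : ∀ z, ‖q‖ ≤ ‖z‖ → ‖z‖ ≤ 1 → DifferentiableAt ℂ F z) :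
    (∮ z in C(0, 1), z⁻¹ * F (q * z)) = ∮ z in C(0, 1), z⁻¹ * F z := by
  rw [circleIntegral_inv_mul_comp_mul F q hq0]
  have h := Complex.circleIntegral_sub_center_inv_smul_eq_of_differentiable_on_annulus_off_countable
    (c := 0) (f := F) (norm_pos_iff.2 hq0) hq Set.countable_empty ?_ ?_
  · simpa using h.symm
  · intro z hz
    simp at hz
    exact (hF z hz.2 hz.1).continuousAt.continuousWithinAt
  · intro z hz
    simp at hz
    exact hF z hz.2.le hz.1.le

theorem circleIntegral_inv_mul_comp_mul_eq_of_ne_zero {F : ℂ → ℂ} {r : ℂ} (hr : r ≠ 0)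
    (hF : ∀ z, z ≠ 0 → DifferentiableAt ℂ F z) :
    (∮ z in C(0, 1), z⁻¹ * F (r * z)) = ∮ z in C(0, 1), z⁻¹ * F z := by
  rcases le_total ‖r‖ 1 with h | h
  · exact circleIntegral_inv_mul_comp_mul_eq hr h fun z hz _ =>
      hF z (norm_pos_iff.1 ((norm_pos_iff.2 hr).trans_le hz))
  · have h1 : ‖r⁻¹‖ ≤ 1 := by rw [norm_inv]; exact inv_le_one_of_one_le₀ h
    have h2 := circleIntegral_inv_mul_comp_mul_eq (F := fun z => F (r * z)) (inv_ne_zero hr) h1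
      fun z hz _ => by
        have hz0 : z ≠ 0 := norm_pos_iff.1 ((norm_pos_iff.2 (inv_ne_zero hr)).trans_le hz)
        exact (hF (r * z) (mul_ne_zero hr hz0)).comp z (by fun_prop)
    rw [← h2]
    simp [mul_inv_cancel_left₀ hr]

/-- A continuous function on the unit circle is determined by its Fourier coefficients. -/
theorem eq_zero_of_circleIntegral_zpow_eq_zero {h : ℂ → ℂ}
    (hc : ContinuousOn h (Metric.sphere 0 1))
    (h0 : ∀ n : ℤ, (∮ z in C(0, 1), z⁻¹ * (z ^ n * h z)) = 0) {z : ℂ} (hz : ‖z‖ = 1) :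
    h z = 0 := by
  have : Fact (0 < 2 * Real.pi) := ⟨Real.two_pi_pos⟩
  let f : C(AddCircle (2 * Real.pi), ℂ) :=
    ⟨fun x => h (AddCircle.toCircle x), by
      refine hc.comp_continuous (by fun_prop) fun x =>
        mem_sphere_zero_iff_norm.2 (Circle.norm_coe _)⟩
  have hf : ∀ n : ℤ, fourierCoeff f n = 0 := by
    intro n
    rw [fourierCoeff_eq_intervalIntegral f n 0]
    have := h0 (-n)
    unfold circleIntegral at this
    rw [zero_add]
    have e : ∀ x : ℝ, fourier (-n) (x : AddCircle (2 * Real.pi)) • f x =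
        (-I) * (deriv (circleMap 0 1) x • ((circleMap 0 1 x)⁻¹ *
          (circleMap 0 1 x ^ (-n) * h (circleMap 0 1 x)))) := by
      intro x
      have hx : circleMap 0 1 x ≠ 0 := circleMap_ne_center one_ne_zero
      have e1 : ((AddCircle.toCircle (x : AddCircle (2 * Real.pi)) : Circle) : ℂ) =
          circleMap 0 1 x := by
        rw [AddCircle.toCircle_apply_mk, div_self Real.two_pi_pos.ne']
        simp [circleMap, Circle.coe_exp]
      have e2 : fourier (-n) (x : AddCircle (2 * Real.pi)) = circleMap 0 1 x ^ (-n) := by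
        rw [fourier_apply, AddCircle.toCircle_zsmul, Circle.coe_zpow, e1]
      have e3 : f x = h (circleMap 0 1 x) := by
        change h _ = _
        rw [e1]
      rw [e2, e3, deriv_circleMap, smul_eq_mul, smul_eq_mul]
      field_simp
      linear_combination h (circleMap 0 1 x) * I_sq
    simp only [e]
    rw [intervalIntegral.integral_const_mul, this]
    simp
  -- Vanishing coefficients are summable, so the Fourier series converges pointwise to `f`; its sum
  -- is 0.
  have hs : Summable (fourierCoeff f) := by
    rw [show fourierCoeff f = fun _ => 0 from funext hf]; exact summable_zero
  have := has_pointwise_sum_fourier_series_of_summable hs (((arg z : ℝ)) : AddCircle (2 * Real.pi))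
  simp only [hf, zero_smul] at this
  have h2 := this.unique hasSum_zero
  change h _ = 0 at h2
  rw [AddCircle.toCircle_apply_mk, div_self Real.two_pi_pos.ne', one_mul, Circle.coe_exp] at h2
  have hz' := norm_mul_exp_arg_mul_I z
  rw [hz, ofReal_one, one_mul] at hz'
  rwa [hz'] at h2

/-- A holomorphic theta function of degree two is determined by two of its Laurent coefficients. -/
theorem eq_zero_of_quasiperiodic {h : ℂ → ℂ} {p C : ℂ} (hp0 : p ≠ 0) (hC : C ≠ 0)
    (hd : ∀ z, z ≠ 0 → DifferentiableAt ℂ h z)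
    (hq : ∀ z, z ≠ 0 → h (p * z) * z ^ 2 = C * h z)
    (h0 : (∮ z in C(0, 1), z⁻¹ * h z) = 0) (h1 : (∮ z in C(0, 1), z⁻¹ * (z * h z)) = 0)
    {z : ℂ} (hz : z ≠ 0) : h z = 0 := by
  set e : ℤ → ℂ := fun n => ∮ z in C(0, 1), z⁻¹ * (z ^ n * h z) with he
  have hdn : ∀ n : ℤ, ∀ z, z ≠ 0 → DifferentiableAt ℂ (fun z => z ^ n * h z) z := fun n z hz =>
    (differentiableAt_zpow.2 (Or.inl hz)).mul (hd z hz)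
  -- Replacing z by pz in the coefficient integral turns the functional equation into a two-step
  -- recurrence, so `e 0` and `e 1` determine every `e n` in both directions.
  have hrec : ∀ n : ℤ, e n = p ^ n * C * e (n - 2) := by
    intro n
    simp only [he]
    rw [← circleIntegral_inv_mul_comp_mul_eq_of_ne_zero hp0 (hdn n),
      ← circleIntegral.integral_const_mul]
    refine circleIntegral.integral_congr zero_le_one fun z hz => ?_
    have hz0 : z ≠ 0 := by
      rintro rfl; simp at hz
    have := hq z hz0
    have e1 : h (p * z) = C * h z / z ^ 2 := by rw [eq_div_iff (pow_ne_zero 2 hz0), this]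
    simp only [e1, mul_zpow, zpow_sub₀ hz0]
    field_simp
  have hall : ∀ n : ℤ, e n = 0 ∧ e (n + 1) = 0 := by
    intro n
    induction n with
    | zero => exact ⟨by simpa [he] using h0, by simpa [he] using h1⟩
    | succ n ih =>
      refine ⟨ih.2, ?_⟩
      rw [hrec, show ((n : ℤ) + 1 + 1 - 2) = n by ring, ih.1, mul_zero]
    | pred n ih =>
      refine ⟨?_, by simpa using ih.1⟩
      have := hrec (-(n : ℤ) + 1)
      rw [ih.2, show (-(n : ℤ) + 1 - 2) = -n - 1 by ring] at this
      have h2 := mul_eq_zero.1 this.symm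
      exact h2.resolve_left (mul_ne_zero (zpow_ne_zero _ hp0) hC)
  -- The same coefficients vanish on the circle through `z`, so uniqueness on the unit circle
  -- applies to w ↦ h (z * w), evaluated at w = 1.
  have hr : ∀ n : ℤ, (∮ w in C(0, 1), w⁻¹ * (w ^ n * h (z * w))) = 0 := by
    intro n
    have h3 := circleIntegral_inv_mul_comp_mul_eq_of_ne_zero hz (hdn n)
    have h4 : (∮ w in C(0, 1), w⁻¹ * ((z * w) ^ n * h (z * w))) =
        z ^ n * ∮ w in C(0, 1), w⁻¹ * (w ^ n * h (z * w)) := by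
      rw [← circleIntegral.integral_const_mul]
      congr 1; ext w; rw [mul_zpow]; ring
    rw [h4] at h3
    have h5 : (∮ w in C(0, 1), w⁻¹ * (w ^ n * h w)) = 0 := (hall n).1
    rw [h5] at h3
    exact (mul_eq_zero.1 h3).resolve_left (zpow_ne_zero _ hz)
  have := eq_zero_of_circleIntegral_zpow_eq_zero (h := fun w => h (z * w)) (fun w hw => by
    have hw0 : w ≠ 0 := by
      rintro rfl; simp at hw
    exact ((hd _ (mul_ne_zero hz hw0)).continuousAt.comp (f := fun w => z * w)
      (by fun_prop)).continuousWithinAt)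
    hr (z := 1) (by simp)
  simpa using this

/-! ### Weierstrass' three-term identity. -/

/-- The antisymmetric function `θ(xy; p) θ(x/y; p) / x`. -/
noncomputable def thetaPair (p x y : ℂ) : ℂ := qTheta (x * y) p * qTheta (x / y) p / x

theorem thetaPair_antisymm {p x y : ℂ} (hp0 : p ≠ 0) (hp : ‖p‖ < 1) (hx : x ≠ 0) (hy : y ≠ 0) :
    thetaPair p y x = -thetaPair p x y := by
  unfold thetaPair
  rw [← inv_div x y, qTheta_inv (div_ne_zero hx hy) hp0 hp, mul_comm y x]
  field_simp

theorem thetaPair_mul_base {p x z : ℂ} (hp0 : p ≠ 0) (hp : ‖p‖ < 1) (hx : x ≠ 0) (hz : z ≠ 0) :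
    thetaPair p x (p * z) * z ^ 2 = p⁻¹ * thetaPair p x z := by
  unfold thetaPair
  have h1 := qTheta_mul_base (mul_ne_zero hx hz) hp0 hp
  have h2 := qTheta_mul_base (z := x / (p * z)) (div_ne_zero hx (mul_ne_zero hp0 hz)) hp0 hp
  rw [show p * (x / (p * z)) = x / z by field_simp] at h2
  rw [show x * (p * z) = p * (x * z) by ring, h1, h2]
  field_simp

theorem differentiableAt_thetaPair {p x z : ℂ} (hp : ‖p‖ < 1) (hx : x ≠ 0) (hz : z ≠ 0) :
    DifferentiableAt ℂ (thetaPair p x) z := by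
  unfold thetaPair
  have h1 : DifferentiableAt ℂ (fun y => qTheta (x * y) p) z :=
    (differentiableAt_qTheta (mul_ne_zero hx hz) hp).comp (f := fun y => x * y) z (by fun_prop)
  have h2 : DifferentiableAt ℂ (fun y => qTheta (x / y) p) z :=
    (differentiableAt_qTheta (div_ne_zero hx hz) hp).comp (f := fun y => x / y) z
      (by fun_prop (disch := assumption))
  fun_prop

/-- In the second variable the three functions share the same quasiperiodicity of degree two, and
such a function is determined by two Laurent coefficients. Three vectors of two coefficients are
linearly dependent. -/
theorem exists_thetaPair_relation {p : ℂ} (hp0 : p ≠ 0) (hp : ‖p‖ < 1) {x : Fin 3 → ℂ}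
    (hx : ∀ i, x i ≠ 0) :
    ∃ a : Fin 3 → ℂ, a ≠ 0 ∧ ∀ z, z ≠ 0 → ∑ i, a i * thetaPair p (x i) z = 0 := by
  let M : Matrix (Fin 2) (Fin 3) ℂ :=
    ![fun i => ∮ z in C(0, 1), z⁻¹ * thetaPair p (x i) z,
      fun i => ∮ z in C(0, 1), z⁻¹ * (z * thetaPair p (x i) z)]
  have hker : LinearMap.ker M.mulVecLin ≠ ⊥ := by
    apply LinearMap.ker_ne_bot_of_finrank_lt
    simp
  obtain ⟨a, ha, ha0⟩ := Submodule.exists_mem_ne_zero_of_ne_bot hker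
  refine ⟨a, ha0, fun z hz => ?_⟩
  have hm : M.mulVec a = 0 := by simpa using ha
  have hci : ∀ (k : ℕ) (i : Fin 3),
      CircleIntegrable (fun z => z⁻¹ * (z ^ k * thetaPair p (x i) z)) 0 1 := by
    intro k i
    refine ContinuousOn.circleIntegrable zero_le_one fun z hz => ?_
    have hz0 : z ≠ 0 := by
      rintro rfl; simp at hz
    have := differentiableAt_thetaPair hp (hx i) hz0
    exact ((differentiableAt_inv hz0).mul
      ((differentiableAt_pow k).mul this)).continuousAt.continuousWithinAt
  have hint : ∀ k : ℕ, (∮ z in C(0, 1), z⁻¹ * (z ^ k * ∑ i, a i * thetaPair p (x i) z)) =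
      ∑ i, (∮ z in C(0, 1), z⁻¹ * (z ^ k * thetaPair p (x i) z)) * a i := by
    intro k
    have e : ∀ i, (∮ z in C(0, 1), z⁻¹ * (z ^ k * thetaPair p (x i) z)) * a i =
        ∮ z in C(0, 1), a i * (z⁻¹ * (z ^ k * thetaPair p (x i) z)) := by
      intro i
      rw [circleIntegral.integral_const_mul, mul_comm]
    simp only [e]
    rw [← circleIntegral.integral_fun_sum]
    · congr 1; ext z
      rw [Finset.mul_sum, Finset.mul_sum]
      refine Finset.sum_congr rfl fun i _ => by ring
    · intro i _
      exact (hci k i).const_smul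
  refine eq_zero_of_quasiperiodic hp0 (inv_ne_zero hp0) (h := fun z =>
    ∑ i, a i * thetaPair p (x i) z) ?_ ?_ ?_ ?_ hz
  · intro z hz
    refine DifferentiableAt.fun_sum fun i _ => ?_
    exact (differentiableAt_thetaPair hp (hx i) hz).const_mul _
  · intro z hz
    rw [Finset.sum_mul, Finset.mul_sum]
    refine Finset.sum_congr rfl fun i _ => ?_
    linear_combination a i * thetaPair_mul_base hp0 hp (hx i) hz
  · have h := congrFun hm 0
    have h2 := hint 0
    simp only [pow_zero, one_mul] at h2
    rw [h2]
    simpa [M, Matrix.mulVec, dotProduct] using h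
  · have h := congrFun hm 1
    have h2 := hint 1
    simp only [pow_one] at h2
    rw [h2]
    simpa [M, Matrix.mulVec, dotProduct] using h

/-- **Weierstrass' three-term identity** for theta functions. -/
theorem thetaPair_three_term {p x y z w : ℂ} (hp0 : p ≠ 0) (hp : ‖p‖ < 1)
    (hx : x ≠ 0) (hy : y ≠ 0) (hz : z ≠ 0) (hw : w ≠ 0) :
    thetaPair p y z * thetaPair p x w + thetaPair p z x * thetaPair p y w
      + thetaPair p x y * thetaPair p z w = 0 := by
  obtain ⟨a, ha, h⟩ := exists_thetaPair_relation hp0 hp (x := ![x, y, z])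
    (by intro i; fin_cases i <;> assumption)
  have self : ∀ u, u ≠ 0 → thetaPair p u u = 0 := by
    intro u hu
    simp [thetaPair, hu, qTheta_one hp]
  -- Evaluating at `x`, `y`, `z` forces `a` to be proportional to (P(y,z), P(z,x), P(x,y)), with P =
  -- `thetaPair p`; evaluating at `w` then gives the identity.
  have hX := h x hx
  have hY := h y hy
  have hZ := h z hz
  have hW := h w hw
  simp only [Fin.sum_univ_three, Matrix.cons_val_zero, Matrix.cons_val_one,
    Matrix.cons_val] at hX hY hZ hW
  rw [self x hx, thetaPair_antisymm hp0 hp hx hy] at hX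
  rw [self y hy, thetaPair_antisymm hp0 hp hy hz] at hY
  rw [self z hz, thetaPair_antisymm hp0 hp hz hx] at hZ
  have h012 : a 0 ≠ 0 ∨ a 1 ≠ 0 ∨ a 2 ≠ 0 := by
    by_contra hcon
    push Not at hcon
    apply ha
    ext i
    fin_cases i
    · exact hcon.1
    · exact hcon.2.1
    · exact hcon.2.2
  rcases h012 with h' | h' | h' <;> apply mul_left_cancel₀ h' <;> rw [mul_zero]
  · linear_combination thetaPair p y z * hW + thetaPair p z w * hY - thetaPair p y w * hZ
  · linear_combination thetaPair p z x * hW - thetaPair p z w * hX + thetaPair p x w * hZ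
  · linear_combination thetaPair p x y * hW + thetaPair p y w * hX - thetaPair p x w * hY

/-! ### The six-parameter theta identity. -/

theorem qTheta_mul_eq_thetaPair {p x y u v : ℂ} (hx : x ≠ 0) (hu : u = x * y) (hv : v = x / y) :
    qTheta u p * qTheta v p = x * thetaPair p x y := by
  rw [hu, hv, thetaPair]
  field_simp

/-- This is the three-term identity at (na, nz, nd, b/n) with n² = bc; the square root puts every
product of two thetas in the form θ(uv)θ(u/v). -/
theorem qTheta_four_term {p a b c d z : ℂ} (hp0 : p ≠ 0) (hp : ‖p‖ < 1)
    (ha : a ≠ 0) (hb : b ≠ 0) (hc : c ≠ 0) (hd : d ≠ 0) (hz : z ≠ 0) :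
    z * (qTheta (a / z) p * qTheta (a * b * c * z) p * (qTheta (d * b) p * qTheta (d * c) p)
      - qTheta (d / z) p * qTheta (d * b * c * z) p * (qTheta (a * b) p * qTheta (a * c) p)) =
    -(a * (qTheta (d / a) p * qTheta (a * b * c * d) p) *
      (qTheta (b * z) p * qTheta (c * z) p)) := by
  obtain ⟨n, hn⟩ := IsAlgClosed.exists_pow_nat_eq (b * c) two_pos
  have hn0 : n ≠ 0 := by
    rintro rfl
    exact mul_ne_zero hb hc (by rw [← hn]; ring)
  have hc' : c = n ^ 2 / b := by rw [hn]; field_simp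
  have e1 : qTheta (a / z) p * qTheta (a * b * c * z) p = n * a * thetaPair p (n * a) (n * z) := by
    rw [mul_comm]
    exact qTheta_mul_eq_thetaPair (by positivity) (by rw [hc']; field_simp) (by field_simp)
  have e2 : qTheta (d / z) p * qTheta (d * b * c * z) p = n * d * thetaPair p (n * d) (n * z) := by
    rw [mul_comm]
    exact qTheta_mul_eq_thetaPair (by positivity) (by rw [hc']; field_simp) (by field_simp)
  have e3 : qTheta (d * b) p * qTheta (d * c) p = n * d * thetaPair p (n * d) (b / n) :=
    qTheta_mul_eq_thetaPair (by positivity) (by field_simp) (by rw [hc']; field_simp)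
  have e4 : qTheta (a * b) p * qTheta (a * c) p = n * a * thetaPair p (n * a) (b / n) :=
    qTheta_mul_eq_thetaPair (by positivity) (by field_simp) (by rw [hc']; field_simp)
  have e5 : qTheta (d / a) p * qTheta (a * b * c * d) p =
      n * d * thetaPair p (n * d) (n * a) := by
    rw [mul_comm]
    exact qTheta_mul_eq_thetaPair (by positivity) (by rw [hc']; field_simp) (by field_simp)
  have e6 : qTheta (b * z) p * qTheta (c * z) p = n * z * thetaPair p (n * z) (b / n) :=
    qTheta_mul_eq_thetaPair (by positivity) (by field_simp) (by rw [hc']; field_simp)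
  rw [e1, e2, e3, e4, e5, e6]
  have W := thetaPair_three_term (x := n * a) (y := n * z) (z := n * d) (w := b / n) hp0 hp
    (by positivity) (by positivity) (by positivity) (by positivity)
  rw [thetaPair_antisymm hp0 hp (x := n * d) (y := n * z) (by positivity) (by positivity)] at W
  linear_combination z * n * a * n * d * W

/-- The theta function identity behind the `q`-difference equation of the elliptic beta
integral. -/
theorem qTheta_six_parameter {p z : ℂ} {x : Fin 6 → ℂ} (hp0 : p ≠ 0) (hp : ‖p‖ < 1)
    (hx : ∀ j, x j ≠ 0) (hz : z ≠ 0) (hprod : x 0 * x 1 * x 2 * x 3 * x 4 * x 5 = p)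
    (h23 : qTheta (x 2 * x 3) p ≠ 0) :
    qTheta (z ^ 2) p * (qTheta (x 0 * z) p * qTheta (x 0 / z) p *
        (qTheta (x 1 * x 2) p * qTheta (x 1 * x 3) p * qTheta (x 1 * x 4) p * qTheta (x 1 * x 5) p)
      - qTheta (x 1 * z) p * qTheta (x 1 / z) p *
        (qTheta (x 0 * x 2) p * qTheta (x 0 * x 3) p * qTheta (x 0 * x 4) p *
          qTheta (x 0 * x 5) p)) =
    x 0 * qTheta (x 1 / x 0) p *
      (z ^ 3 * (qTheta (x 0 / z) p * qTheta (x 1 / z) p * qTheta (x 2 / z) p *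
          qTheta (x 3 / z) p * qTheta (x 4 / z) p * qTheta (x 5 / z) p)
        - z⁻¹ * (qTheta (x 0 * z) p * qTheta (x 1 * z) p * qTheta (x 2 * z) p *
          qTheta (x 3 * z) p * qTheta (x 4 * z) p * qTheta (x 5 * z) p)) := by
  have h0 := hx 0
  have h1 := hx 1
  have h2 := hx 2
  have h3 := hx 3
  have h4 := hx 4
  have h5 := hx 5
  obtain ⟨m, hm⟩ := IsAlgClosed.exists_pow_nat_eq (x 2 * x 3) two_pos
  have hm0 : m ≠ 0 := by
    rintro rfl
    exact mul_ne_zero h2 h3 (by rw [← hm]; ring)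
  have hx3 : x 3 = m ^ 2 / x 2 := by rw [hm]; field_simp
  -- The three-term identity at (αm, mz, m/z, x₂/m), used for α = x₁ and α = x₀. It is the reason
  -- for multiplying the goal by θ(x₂x₃).
  have expand : ∀ α, α ≠ 0 → qTheta (x 2 * x 3) p * qTheta (z ^ 2) p *
      (qTheta (α * x 2) p * qTheta (α * x 3) p) =
      m * z * (qTheta (α * (x 2 * x 3) / z) p * qTheta (α * z) p * thetaPair p (m * z) (x 2 / m)
        - qTheta (α * (x 2 * x 3) * z) p * qTheta (α / z) p * thetaPair p (m / z) (x 2 / m)) := by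
    intro α hα
    have e1 : qTheta (x 2 * x 3) p * qTheta (z ^ 2) p = m * z * thetaPair p (m * z) (m / z) :=
      qTheta_mul_eq_thetaPair (by positivity) (by rw [hx3]; field_simp) (by field_simp)
    have e2 : qTheta (α * x 2) p * qTheta (α * x 3) p = α * m * thetaPair p (α * m) (x 2 / m) :=
      qTheta_mul_eq_thetaPair (by positivity) (by field_simp) (by rw [hx3]; field_simp)
    have e3 : qTheta (α * (x 2 * x 3) / z) p * qTheta (α * z) p =
        α * m * thetaPair p (α * m) (m / z) :=
      qTheta_mul_eq_thetaPair (by positivity) (by rw [hx3]; field_simp) (by field_simp)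
    have e4 : qTheta (α * (x 2 * x 3) * z) p * qTheta (α / z) p =
        α * m * thetaPair p (α * m) (m * z) :=
      qTheta_mul_eq_thetaPair (by positivity) (by rw [hx3]; field_simp) (by field_simp)
    rw [e1, e2, e3, e4]
    have W := thetaPair_three_term (x := α * m) (y := m * z) (z := m / z) (w := x 2 / m) hp0 hp
      (by positivity) (by positivity) (by positivity) (by positivity)
    rw [thetaPair_antisymm hp0 hp (x := α * m) (y := m / z) (by positivity) (by positivity)] at W
    linear_combination m * z * α * m * W
  have R : ∀ u v, u * v = p → qTheta u p = qTheta v p := by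
    intro u v huv
    have hv : v ≠ 0 := by rintro rfl; exact hp0 (by rw [← huv, mul_zero])
    rw [← qTheta_base_div (z := v) hp0, ← huv]
    congr 1
    field_simp
  have hprod' : x 0 * x 1 * (x 2 * x 3) * x 4 * x 5 = p := by rw [← hprod]; ring
  -- After `expand`, the left side is a combination of P(mz, x₂/m) and P(m/z, x₂/m), with P =
  -- `thetaPair p`. Their coefficients are evaluated by the four-term identity at z and at z⁻¹, once
  -- balancing and θ(u) = θ(p/u) have rewritten the triple products.
  have c1 := qTheta_four_term hp0 hp h0 h4 h5 h1 hz
  have c2 := qTheta_four_term hp0 hp h0 h4 h5 h1 (inv_ne_zero hz)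
  have r1 : ∀ w, w ≠ 0 → qTheta (x 0 * x 4 * x 5 * w) p = qTheta (x 1 * (x 2 * x 3) / w) p :=
    fun w hw => R _ _ (by rw [← hprod']; field_simp)
  have r2 : ∀ w, w ≠ 0 → qTheta (x 1 * x 4 * x 5 * w) p = qTheta (x 0 * (x 2 * x 3) / w) p :=
    fun w hw => R _ _ (by rw [← hprod']; field_simp)
  have r3 : qTheta (x 0 * x 4 * x 5 * x 1) p = qTheta (x 2 * x 3) p :=
    R _ _ (by rw [← hprod']; ring)
  rw [r1 z hz, r2 z hz, r3] at c1
  rw [r1 _ (inv_ne_zero hz), r2 _ (inv_ne_zero hz), r3] at c2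
  simp only [div_inv_eq_mul, ← div_eq_mul_inv] at c2
  have f1 : qTheta (x 2 * z) p * qTheta (x 3 * z) p = m * z * thetaPair p (m * z) (x 2 / m) :=
    qTheta_mul_eq_thetaPair (by positivity) (by field_simp) (by rw [hx3]; field_simp)
  have f2 : qTheta (x 2 / z) p * qTheta (x 3 / z) p = m / z * thetaPair p (m / z) (x 2 / m) :=
    qTheta_mul_eq_thetaPair (by positivity) (by field_simp) (by rw [hx3]; field_simp)
  have E1 := expand _ h1
  have E0 := expand _ h0
  apply mul_left_cancel₀ h23
  have f2' : z * (qTheta (x 2 / z) p * qTheta (x 3 / z) p) =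
      m * thetaPair p (m / z) (x 2 / m) := by rw [f2]; field_simp
  have f1' : z⁻¹ * (qTheta (x 2 * z) p * qTheta (x 3 * z) p) =
      m * thetaPair p (m * z) (x 2 / m) := by rw [f1]; field_simp
  have c2' : qTheta (x 0 * z) p * qTheta (x 1 * (x 2 * x 3) * z) p *
        (qTheta (x 1 * x 4) p * qTheta (x 1 * x 5) p) -
      qTheta (x 1 * z) p * qTheta (x 0 * (x 2 * x 3) * z) p *
        (qTheta (x 0 * x 4) p * qTheta (x 0 * x 5) p) =
      -(z * (x 0 * (qTheta (x 1 / x 0) p * qTheta (x 2 * x 3) p) *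
        (qTheta (x 4 / z) p * qTheta (x 5 / z) p))) := by
    rw [← mul_right_inj' (inv_ne_zero hz), c2]
    field_simp
  linear_combination
    qTheta (x 0 * z) p * qTheta (x 0 / z) p * (qTheta (x 1 * x 4) p * qTheta (x 1 * x 5) p) * E1
    - qTheta (x 1 * z) p * qTheta (x 1 / z) p * (qTheta (x 0 * x 4) p * qTheta (x 0 * x 5) p) * E0
    + m * qTheta (x 0 * z) p * qTheta (x 1 * z) p * thetaPair p (m * z) (x 2 / m) * c1
    - m * z * qTheta (x 0 / z) p * qTheta (x 1 / z) p * thetaPair p (m / z) (x 2 / m) * c2'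
    - qTheta (x 2 * x 3) p * x 0 * qTheta (x 1 / x 0) p * z ^ 2 * qTheta (x 0 / z) p *
      qTheta (x 1 / z) p * qTheta (x 4 / z) p * qTheta (x 5 / z) p * f2'
    + qTheta (x 2 * x 3) p * x 0 * qTheta (x 1 / x 0) p * qTheta (x 0 * z) p *
      qTheta (x 1 * z) p * qTheta (x 4 * z) p * qTheta (x 5 * z) p * f1'

/-! ### The elliptic gamma function. -/

theorem ellipticGamma_base_mul {z p q : ℂ} (hp : ‖p‖ < 1) (hq : ‖q‖ < 1)
    (hq0 : q ≠ 0) (hz0 : z ≠ 0) (hz : ‖z‖ < 1) :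
    ellipticGamma (q * z) p q = qTheta z p * ellipticGamma z p q := by
  unfold ellipticGamma qTheta
  have h1 := pqPochInf_eq_mul z hp hq
  have h2 := pqPochInf_eq_mul (p / z) hp hq
  have hQ := qPochInf_ne_zero hp hz
  rw [show p * q * (q * z)⁻¹ = p / z by field_simp, h2, h1,
    show q * (p / z) = p * q * z⁻¹ by field_simp]
  field_simp

theorem ellipticGamma_mul_reflect {y z p q : ℂ} (hp : ‖p‖ < 1) (hq : ‖q‖ < 1)
    (hyz : y * z = p * q) (hy0 : y ≠ 0) (hz0 : z ≠ 0) (hy : ‖y‖ < 1) (hz : ‖z‖ < 1) :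
    ellipticGamma y p q * ellipticGamma z p q = 1 := by
  unfold ellipticGamma
  have h1 := pqPochInf_ne_zero hp hq hz
  have h2 := pqPochInf_ne_zero hp hq hy
  rw [← hyz, show y * z * y⁻¹ = z by field_simp, show y * z * z⁻¹ = y by field_simp]
  field_simp

theorem ellipticGamma_ne_zero {z p q : ℂ} (hp : ‖p‖ < 1) (hq : ‖q‖ < 1)
    (hz : ‖z‖ < 1) (hz' : ‖p * q‖ < ‖z‖) : ellipticGamma z p q ≠ 0 := by
  have hz0 : 0 < ‖z‖ := (norm_nonneg _).trans_lt hz'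
  refine div_ne_zero (pqPochInf_ne_zero hp hq ?_) (pqPochInf_ne_zero hp hq hz)
  rwa [← div_eq_mul_inv, norm_div, div_lt_one hz0]

theorem differentiableAt_ellipticGamma {z p q : ℂ} (hp : ‖p‖ < 1) (hq : ‖q‖ < 1)
    (hz0 : z ≠ 0) (hz : ‖z‖ < 1) : DifferentiableAt ℂ (fun z => ellipticGamma z p q) z := by
  unfold ellipticGamma
  have h := differentiable_pqPochInf hp hq
  exact ((h _).comp z (by fun_prop (disch := assumption))).div (h z) (pqPochInf_ne_zero hp hq hz)

/-! ### The integrand, the integral and the gamma product. -/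

/-- A holomorphic form of `ellipticBetaDensity`, equal to it on the unit circle. -/
noncomputable def regularBetaDensity (t : Fin 6 → ℂ) (p q z : ℂ) : ℂ :=
  qTheta (z ^ 2) p * qTheta (z ^ 2)⁻¹ q *
    ∏ j : Fin 6, ellipticGamma (t j * z) p q * ellipticGamma (t j * z⁻¹) p q

/-- Peeling one p-product and one q-product off each of (w;p,q)_∞ and (w⁻¹;p,q)_∞ leaves exactly the
numerators of the two gamma factors. No nonvanishing of (w;p,q)_∞ is used, so w = 1 is covered: the
default value of the gamma function gives 0 on the left, and θ(1) = 0 on the right. -/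
theorem inv_ellipticGamma_mul_inv {w p q : ℂ} (hp : ‖p‖ < 1) (hq : ‖q‖ < 1) (hw : ‖w‖ = 1) :
    (ellipticGamma w p q * ellipticGamma w⁻¹ p q)⁻¹ = qTheta w p * qTheta w⁻¹ q := by
  have hpq : ‖p * q‖ < 1 := by
    rw [norm_mul]; exact mul_lt_one_of_nonneg_of_lt_one_left (norm_nonneg _) hp hq.le
  have h1 : pqPochInf (p * q * w) p q ≠ 0 :=
    pqPochInf_ne_zero hp hq (by rwa [norm_mul, hw, mul_one])
  have h2 : pqPochInf (p * q * w⁻¹) p q ≠ 0 :=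
    pqPochInf_ne_zero hp hq (by rwa [norm_mul, norm_inv, hw, inv_one, mul_one])
  have e1 : pqPochInf w p q = qPochInf w p * (qPochInf (q * w) q * pqPochInf (p * q * w) p q) := by
    rw [pqPochInf_eq_mul w hp hq, pqPochInf_eq_mul' (q * w) hp hq, mul_assoc p]
  have e2 : pqPochInf w⁻¹ p q =
      qPochInf w⁻¹ q * (qPochInf (p * w⁻¹) p * pqPochInf (p * q * w⁻¹) p q) := by
    rw [pqPochInf_eq_mul' w⁻¹ hp hq, pqPochInf_eq_mul (p * w⁻¹) hp hq, ← mul_assoc q, mul_comm q p]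
  rw [ellipticGamma, ellipticGamma, inv_inv, qTheta, qTheta, e1, e2, div_inv_eq_mul,
    div_eq_mul_inv p w, mul_inv, inv_div, inv_div]
  generalize pqPochInf (p * q * w) p q = A at *
  generalize pqPochInf (p * q * w⁻¹) p q = B at *
  field_simp

theorem ellipticBetaDensity_eq_regular {t : Fin 6 → ℂ} {z p q : ℂ} (hp : ‖p‖ < 1) (hq : ‖q‖ < 1)
    (hz : ‖z‖ = 1) : ellipticBetaDensity t p q z = regularBetaDensity t p q z := by
  rw [ellipticBetaDensity, regularBetaDensity, div_eq_mul_inv,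
    inv_ellipticGamma_mul_inv hp hq (by rw [norm_pow, hz, one_pow]), mul_comm]

/-- The elliptic beta integral without its normalizing constant. -/
noncomputable def ellipticBetaIntegral (t : Fin 6 → ℂ) (p q : ℂ) : ℂ :=
  ∮ z in C(0, 1), z⁻¹ * regularBetaDensity t p q z

/-- The product of gamma functions evaluating the elliptic beta integral. -/
noncomputable def ellipticBetaProduct (t : Fin 6 → ℂ) (p q : ℂ) : ℂ :=
  ∏ j : Fin 6, ∏ k ∈ Finset.Ioi j, ellipticGamma (t j * t k) p q

theorem ellipticBetaProduct_eq (t : Fin 6 → ℂ) (p q : ℂ) :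
    ellipticBetaProduct t p q =
      ellipticGamma (t 0 * t 1) p q * ellipticGamma (t 0 * t 2) p q * ellipticGamma (t 0 * t 3) p q *
      ellipticGamma (t 0 * t 4) p q * ellipticGamma (t 0 * t 5) p q * ellipticGamma (t 1 * t 2) p q *
      ellipticGamma (t 1 * t 3) p q * ellipticGamma (t 1 * t 4) p q * ellipticGamma (t 1 * t 5) p q *
      ellipticGamma (t 2 * t 3) p q * ellipticGamma (t 2 * t 4) p q * ellipticGamma (t 2 * t 5) p q *
      ellipticGamma (t 3 * t 4) p q * ellipticGamma (t 3 * t 5) p q *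
      ellipticGamma (t 4 * t 5) p q := by
  unfold ellipticBetaProduct
  rw [Fin.prod_univ_six, show Finset.Ioi (0 : Fin 6) = {1, 2, 3, 4, 5} from rfl,
    show Finset.Ioi (1 : Fin 6) = {2, 3, 4, 5} from rfl,
    show Finset.Ioi (2 : Fin 6) = {3, 4, 5} from rfl,
    show Finset.Ioi (3 : Fin 6) = {4, 5} from rfl, show Finset.Ioi (4 : Fin 6) = {5} from rfl,
    show Finset.Ioi (5 : Fin 6) = ∅ from rfl]
  repeat rw [Finset.prod_insert (by decide)]
  simp only [Finset.prod_singleton, Finset.prod_empty]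
  ring

/-- The domain of the elliptic beta integral. -/
structure IsBetaParam (t : Fin 6 → ℂ) (p q : ℂ) : Prop where
  norm_lt_one : ∀ j, ‖t j‖ < 1
  prod_eq : ∏ j, t j = p * q

theorem IsBetaParam.ne_zero {t : Fin 6 → ℂ} {p q : ℂ} (h : IsBetaParam t p q) (hp0 : p ≠ 0)
    (hq0 : q ≠ 0) (j : Fin 6) : t j ≠ 0 :=
  Finset.prod_ne_zero_iff.1 (h.prod_eq ▸ mul_ne_zero hp0 hq0) j (Finset.mem_univ j)

/-- A third index is required for strictness: its factor has norm below 1. -/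
theorem norm_prod_lt_norm_mul {ι : Type*} [Fintype ι] [DecidableEq ι] {x : ι → ℂ}
    (h0 : ∀ j, x j ≠ 0) (h1 : ∀ j, ‖x j‖ < 1) {j k l : ι} (hjk : j ≠ k) (hlj : l ≠ j) (hlk : l ≠ k) :
    ‖∏ i, x i‖ < ‖x j * x k‖ := by
  rw [← Finset.mul_prod_erase _ _ (Finset.mem_univ j),
    ← Finset.mul_prod_erase _ _ (Finset.mem_erase.2 ⟨hjk.symm, Finset.mem_univ k⟩), ← mul_assoc,
    norm_mul]
  refine mul_lt_of_lt_one_right (norm_pos_iff.2 (mul_ne_zero (h0 j) (h0 k))) ?_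
  rw [norm_prod, ← Finset.mul_prod_erase _ _
    (Finset.mem_erase.2 ⟨hlk, Finset.mem_erase.2 ⟨hlj, Finset.mem_univ l⟩⟩)]
  exact mul_lt_one_of_nonneg_of_lt_one_left (norm_nonneg _) (h1 l)
    (Finset.prod_le_one (fun _ _ => norm_nonneg _) fun i _ => (h1 i).le)

theorem exists_ne_ne_fin_six (j k : Fin 6) : ∃ l : Fin 6, l ≠ j ∧ l ≠ k := by
  revert j k; decide

/-- Balancing gives |pq| < |t_j t_k| < 1, and the gamma function has neither zeros nor poles in that
annulus. -/
theorem IsBetaParam.ellipticBetaProduct_ne_zero {t : Fin 6 → ℂ} {p q : ℂ} (h : IsBetaParam t p q)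
    (hp0 : p ≠ 0) (hq0 : q ≠ 0) (hp : ‖p‖ < 1) (hq : ‖q‖ < 1) : ellipticBetaProduct t p q ≠ 0 := by
  refine Finset.prod_ne_zero_iff.2 fun j _ => Finset.prod_ne_zero_iff.2 fun k hk => ?_
  obtain ⟨l, hlj, hlk⟩ := exists_ne_ne_fin_six j k
  refine ellipticGamma_ne_zero hp hq ?_ ?_
  · rw [norm_mul]
    exact mul_lt_one_of_nonneg_of_lt_one_left (norm_nonneg _) (h.norm_lt_one j) (h.norm_lt_one k).le
  · rw [← h.prod_eq]
    exact norm_prod_lt_norm_mul (h.ne_zero hp0 hq0) h.norm_lt_one (Finset.mem_Ioi.1 hk).ne hlj hlk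

/-- The shift produces one theta factor for each pair containing the shifted parameter; the factor
of the pair (0, 1) is common to both sides. -/
theorem ellipticBetaProduct_base_shift {x : Fin 6 → ℂ} {p q : ℂ} (hp : ‖p‖ < 1) (hq : ‖q‖ < 1)
    (hq0 : q ≠ 0) (hx0 : ∀ j, x j ≠ 0) (hx : ∀ j, ‖x j‖ < 1) :
    ellipticBetaProduct ![q * x 0, x 1, x 2, x 3, x 4, x 5] p q *
        (qTheta (x 1 * x 2) p * qTheta (x 1 * x 3) p * qTheta (x 1 * x 4) p * qTheta (x 1 * x 5) p) =
      ellipticBetaProduct ![x 0, q * x 1, x 2, x 3, x 4, x 5] p q *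
        (qTheta (x 0 * x 2) p * qTheta (x 0 * x 3) p * qTheta (x 0 * x 4) p *
          qTheta (x 0 * x 5) p) := by
  have G : ∀ j k, ellipticGamma (q * x j * x k) p q =
      qTheta (x j * x k) p * ellipticGamma (x j * x k) p q := by
    intro j k
    rw [mul_assoc]
    refine ellipticGamma_base_mul hp hq hq0 (mul_ne_zero (hx0 j) (hx0 k)) ?_
    rw [norm_mul]
    exact mul_lt_one_of_nonneg_of_lt_one_left (norm_nonneg _) (hx j) (hx k).le
  rw [ellipticBetaProduct_eq, ellipticBetaProduct_eq]
  simp only [Matrix.cons_val]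
  rw [show x 0 * (q * x 1) = q * x 0 * x 1 by ring]
  simp only [G]
  ring

/-- The space `X` is general so that the result gives both continuity in z and joint continuity in z
and the parameters. -/
theorem continuousOn_regularBetaDensity {X : Type*} [TopologicalSpace X] {s : Set X}
    {t : X → Fin 6 → ℂ} {z : X → ℂ} {p q : ℂ} (hp : ‖p‖ < 1) (hq : ‖q‖ < 1)
    (ht : ContinuousOn t s) (hz : ContinuousOn z s) (ht0 : ∀ x ∈ s, ∀ j, t x j ≠ 0)
    (ht1 : ∀ x ∈ s, ∀ j, ‖t x j‖ < 1) (hz1 : ∀ x ∈ s, ‖z x‖ = 1) :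
    ContinuousOn (fun x => regularBetaDensity (t x) p q (z x)) s := by
  have hz0 : ∀ x ∈ s, z x ≠ 0 := fun x hx h => by simpa [h] using hz1 x hx
  have htj : ∀ j, ContinuousOn (fun x => t x j) s := fun j => (continuous_apply j).comp_continuousOn ht
  have hth : ∀ {r : ℂ}, ‖r‖ < 1 → ∀ {f : X → ℂ}, ContinuousOn f s → (∀ x ∈ s, f x ≠ 0) →
      ContinuousOn (fun x => qTheta (f x) r) s := fun hr f hf hf0 x hx =>
    (differentiableAt_qTheta (hf0 x hx) hr).continuousAt.comp_continuousWithinAt (hf x hx)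
  have hg : ∀ {f : X → ℂ}, ContinuousOn f s → (∀ x ∈ s, f x ≠ 0) → (∀ x ∈ s, ‖f x‖ < 1) →
      ContinuousOn (fun x => ellipticGamma (f x) p q) s := fun {f} hf hf0 hf1 x hx =>
    (differentiableAt_ellipticGamma hp hq (hf0 x hx) (hf1 x hx)).continuousAt.comp_continuousWithinAt
      (hf x hx)
  unfold regularBetaDensity
  refine ((hth hp (hz.pow 2) fun x hx => pow_ne_zero 2 (hz0 x hx)).mul
    (hth hq ((hz.pow 2).inv₀ fun x hx => pow_ne_zero 2 (hz0 x hx))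
      fun x hx => inv_ne_zero (pow_ne_zero 2 (hz0 x hx)))).mul ?_
  refine continuousOn_finsetProd _ fun j _ => (hg ((htj j).mul hz)
    (fun x hx => mul_ne_zero (ht0 x hx j) (hz0 x hx)) fun x hx => ?_).mul
    (hg ((htj j).mul (hz.inv₀ hz0))
    (fun x hx => mul_ne_zero (ht0 x hx j) (inv_ne_zero (hz0 x hx))) fun x hx => ?_)
  · change ‖t x j * z x‖ < 1
    rw [norm_mul, hz1 x hx, mul_one]; exact ht1 x hx j
  · rw [norm_mul, norm_inv, hz1 x hx, inv_one, mul_one]; exact ht1 x hx j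

theorem circleIntegrable_regularBetaDensity {t : Fin 6 → ℂ} {p q : ℂ} (hp : ‖p‖ < 1) (hq : ‖q‖ < 1)
    (ht0 : ∀ j, t j ≠ 0) (ht1 : ∀ j, ‖t j‖ < 1) :
    CircleIntegrable (fun z => z⁻¹ * regularBetaDensity t p q z) 0 1 := by
  refine ContinuousOn.circleIntegrable zero_le_one (ContinuousOn.mul ?_ ?_)
  · exact continuousOn_id.inv₀ fun z hz h => by simp_all
  · exact continuousOn_regularBetaDensity hp hq continuousOn_const continuousOn_id
      (fun _ _ => ht0) (fun _ _ => ht1) fun z hz => by simpa using hz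

/-! ### The q-difference equation. -/

theorem qTheta_inv_sq_mul_base {z q : ℂ} (hz : z ≠ 0) (hq0 : q ≠ 0) (hq : ‖q‖ < 1) :
    qTheta ((q * z) ^ 2)⁻¹ q = (z ^ 4 * q ^ 3)⁻¹ * qTheta (z ^ 2)⁻¹ q := by
  have h1 := qTheta_mul_base (z := ((q * z) ^ 2)⁻¹) (by positivity) hq0 hq
  have h2 := qTheta_mul_base (z := q * ((q * z) ^ 2)⁻¹) (by positivity) hq0 hq
  rw [show q * (q * ((q * z) ^ 2)⁻¹) = (z ^ 2)⁻¹ by field_simp, h1] at h2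
  rw [h2]
  field_simp

/-- The `q`-difference equation of the elliptic beta integral. -/
theorem ellipticBetaIntegral_base_shift {x : Fin 6 → ℂ} {p q : ℂ} (hp : ‖p‖ < 1) (hq : ‖q‖ < 1)
    (hp0 : p ≠ 0) (hq0 : q ≠ 0) (hx : ∀ j, ‖x j‖ < 1) (hprod : ∏ j, x j = p) :
    ellipticBetaIntegral ![q * x 0, x 1, x 2, x 3, x 4, x 5] p q *
        (qTheta (x 1 * x 2) p * qTheta (x 1 * x 3) p * qTheta (x 1 * x 4) p * qTheta (x 1 * x 5) p) =
      ellipticBetaIntegral ![x 0, q * x 1, x 2, x 3, x 4, x 5] p q *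
        (qTheta (x 0 * x 2) p * qTheta (x 0 * x 3) p * qTheta (x 0 * x 4) p *
          qTheta (x 0 * x 5) p) := by
  have hx0 : ∀ j, x j ≠ 0 := fun j =>
    Finset.prod_ne_zero_iff.1 (hprod ▸ hp0) j (Finset.mem_univ j)
  set T1 : Fin 6 → ℂ := ![q * x 0, x 1, x 2, x 3, x 4, x 5] with hT1
  set T2 : Fin 6 → ℂ := ![x 0, q * x 1, x 2, x 3, x 4, x 5] with hT2
  set Θ1 := qTheta (x 1 * x 2) p * qTheta (x 1 * x 3) p * qTheta (x 1 * x 4) p *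
    qTheta (x 1 * x 5) p with hΘ1
  set Θ0 := qTheta (x 0 * x 2) p * qTheta (x 0 * x 3) p * qTheta (x 0 * x 4) p *
    qTheta (x 0 * x 5) p with hΘ0
  have hqx : ∀ j, ‖q * x j‖ < 1 := fun j => by
    rw [norm_mul]; exact mul_lt_one_of_nonneg_of_lt_one_left (norm_nonneg _) hq (hx j).le
  have i1 : CircleIntegrable (fun z => z⁻¹ * regularBetaDensity T1 p q z) 0 1 := by
    refine circleIntegrable_regularBetaDensity hp hq (fun j => ?_) fun j => ?_
    · fin_cases j <;> simp [hT1, hx0, hq0]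
    · fin_cases j <;> simp only [hT1] <;> first | exact hqx 0 | apply hx
  have i2 : CircleIntegrable (fun z => z⁻¹ * regularBetaDensity T2 p q z) 0 1 := by
    refine circleIntegrable_regularBetaDensity hp hq (fun j => ?_) fun j => ?_
    · fin_cases j <;> simp [hT2, hx0, hq0]
    · fin_cases j <;> simp only [hT2] <;> first | exact hqx 1 | apply hx
  -- `F` is chosen so that F(z) and F(qz) carry the two theta products on the right of
  -- `qTheta_six_parameter`. The factor q beside z⁻¹ keeps all gamma arguments in the unit disc for
  -- ‖q‖ ≤ |z| ≤ 1.
  let F : ℂ → ℂ := fun z => z ^ 3 * qTheta (z ^ 2)⁻¹ q *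
    ∏ j : Fin 6, ellipticGamma (x j * z) p q * ellipticGamma (q * (x j * z⁻¹)) p q
  have hFd : ∀ z, ‖q‖ ≤ ‖z‖ → ‖z‖ ≤ 1 → DifferentiableAt ℂ F z := by
    intro z hz1 hz2
    have hz : z ≠ 0 := norm_pos_iff.1 ((norm_pos_iff.2 hq0).trans_le hz1)
    refine ((differentiableAt_pow 3).mul ?_).mul (DifferentiableAt.fun_finsetProd fun j _ => ?_)
    · exact (differentiableAt_qTheta (inv_ne_zero (pow_ne_zero 2 hz)) hq).comp
        (f := fun z : ℂ => (z ^ 2)⁻¹) z (by fun_prop (disch := positivity))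
    · refine DifferentiableAt.mul ?_ ?_
      · refine (differentiableAt_ellipticGamma hp hq (mul_ne_zero (hx0 j) hz) ?_).comp
          (f := fun z : ℂ => x j * z) z (by fun_prop)
        rw [norm_mul]
        exact mul_lt_one_of_nonneg_of_lt_one_left (norm_nonneg _) (hx j) hz2
      · refine (differentiableAt_ellipticGamma hp hq
          (mul_ne_zero hq0 (mul_ne_zero (hx0 j) (inv_ne_zero hz))) ?_).comp
          (f := fun z : ℂ => q * (x j * z⁻¹)) z (by fun_prop (disch := assumption))
        rw [norm_mul, norm_mul, norm_inv]
        calc ‖q‖ * (‖x j‖ * ‖z‖⁻¹) = ‖x j‖ * (‖q‖ / ‖z‖) := by ring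
          _ ≤ ‖x j‖ * 1 := by
            gcongr; exact div_le_one_of_le₀ hz1 (norm_nonneg _)
          _ < 1 := by simpa using hx j
  have hsphere : ∀ z : ℂ, z ∈ Metric.sphere (0 : ℂ) 1 → z ≠ 0 ∧ ‖z‖ = 1 := fun z hz => by
    have h : ‖z‖ = 1 := by simpa using hz
    exact ⟨fun h0 => by simp [h0] at h, h⟩
  have hpt : ∀ z ∈ Metric.sphere (0 : ℂ) 1,
      Θ1 * (z⁻¹ * regularBetaDensity T1 p q z) - Θ0 * (z⁻¹ * regularBetaDensity T2 p q z) =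
      x 0 * qTheta (x 1 / x 0) p * (z⁻¹ * F z - z⁻¹ * F (q * z)) := by
    intro z hz
    obtain ⟨hz0, hz1⟩ := hsphere z hz
    have n1 : ∀ j, ‖x j * z‖ < 1 := fun j => by rw [norm_mul, hz1, mul_one]; exact hx j
    have n2 : ∀ j, ‖x j * z⁻¹‖ < 1 := fun j => by
      rw [norm_mul, norm_inv, hz1, inv_one, mul_one]; exact hx j
    have G1 : ∀ j, ellipticGamma (q * (x j * z)) p q =
        qTheta (x j * z) p * ellipticGamma (x j * z) p q := fun j =>
      ellipticGamma_base_mul hp hq hq0 (mul_ne_zero (hx0 j) hz0) (n1 j)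
    have G2 : ∀ j, ellipticGamma (q * (x j * z⁻¹)) p q =
        qTheta (x j / z) p * ellipticGamma (x j * z⁻¹) p q := fun j => by
      rw [div_eq_mul_inv]
      exact ellipticGamma_base_mul hp hq hq0 (mul_ne_zero (hx0 j) (inv_ne_zero hz0)) (n2 j)
    have hFq : F (q * z) = z⁻¹ * qTheta (z ^ 2)⁻¹ q *
        ∏ j : Fin 6, (qTheta (x j * z) p * ellipticGamma (x j * z) p q) *
          ellipticGamma (x j * z⁻¹) p q := by
      simp only [F]
      rw [qTheta_inv_sq_mul_base hz0 hq0 hq]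
      congr 1
      · field_simp
      · refine Finset.prod_congr rfl fun j _ => ?_
        rw [← G1, show x j * (q * z) = q * (x j * z) by ring,
          show q * (x j * (q * z)⁻¹) = x j * z⁻¹ by field_simp]
    rw [hFq]
    simp only [F, regularBetaDensity, hT1, hT2, Fin.prod_univ_six, Matrix.cons_val, mul_assoc q, G1,
      G2]
    have h23 : qTheta (x 2 * x 3) p ≠ 0 := by
      refine qTheta_ne_zero hp ?_ ?_
      · rw [← hprod]
        exact norm_prod_lt_norm_mul (l := 0) hx0 hx (by decide) (by decide) (by decide)
      · rw [norm_mul]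
        exact mul_lt_one_of_nonneg_of_lt_one_left (norm_nonneg _) (hx 2) (hx 3).le
    have K := qTheta_six_parameter hp0 hp hx0 hz0 (by rw [← hprod, Fin.prod_univ_six]) h23
    rw [← hΘ1, ← hΘ0] at K
    linear_combination z⁻¹ * qTheta (z ^ 2)⁻¹ q *
      (ellipticGamma (x 0 * z) p q * ellipticGamma (x 0 * z⁻¹) p q *
      (ellipticGamma (x 1 * z) p q * ellipticGamma (x 1 * z⁻¹) p q) *
      (ellipticGamma (x 2 * z) p q * ellipticGamma (x 2 * z⁻¹) p q) *
      (ellipticGamma (x 3 * z) p q * ellipticGamma (x 3 * z⁻¹) p q) *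
      (ellipticGamma (x 4 * z) p q * ellipticGamma (x 4 * z⁻¹) p q) *
      (ellipticGamma (x 5 * z) p q * ellipticGamma (x 5 * z⁻¹) p q)) * K
  have hq1 : ∀ z ∈ Metric.sphere (0 : ℂ) 1, ‖q * z‖ = ‖q‖ := fun z hz => by
    rw [norm_mul, (hsphere z hz).2, mul_one]
  have iF : CircleIntegrable (fun z => z⁻¹ * F z) 0 1 :=
    ContinuousOn.circleIntegrable zero_le_one fun z hz =>
      ((differentiableAt_inv (hsphere z hz).1).mul (hFd z (by rw [(hsphere z hz).2]; exact hq.le)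
        (hsphere z hz).2.le)).continuousAt.continuousWithinAt
  have iFq : CircleIntegrable (fun z => z⁻¹ * F (q * z)) 0 1 :=
    ContinuousOn.circleIntegrable zero_le_one fun z hz =>
      ((differentiableAt_inv (hsphere z hz).1).mul ((hFd (q * z) (hq1 z hz).ge
        ((hq1 z hz).le.trans hq.le)).comp (f := fun z => q * z) z
          (by fun_prop))).continuousAt.continuousWithinAt
  -- The contour shift makes the integrals of F(z) and F(qz) equal, so the right side of `hpt`
  -- integrates to 0.
  have hI := circleIntegral_inv_mul_comp_mul_eq hq0 hq.le hFd
  have hI2 := circleIntegral.integral_congr zero_le_one hpt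
  have j1 : CircleIntegrable (fun z => Θ1 * (z⁻¹ * regularBetaDensity T1 p q z)) 0 1 :=
    i1.const_smul (a := Θ1)
  have j2 : CircleIntegrable (fun z => Θ0 * (z⁻¹ * regularBetaDensity T2 p q z)) 0 1 :=
    i2.const_smul (a := Θ0)
  rw [circleIntegral.integral_sub j1 j2,
    circleIntegral.integral_const_mul, circleIntegral.integral_const_mul,
    circleIntegral.integral_const_mul, circleIntegral.integral_sub iF iFq, hI, sub_self,
    mul_zero] at hI2
  unfold ellipticBetaIntegral
  linear_combination hI2

/-- The quotient of the two sides of the elliptic beta integral evaluation, up to a constant. -/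
noncomputable def ellipticBetaRatio (t : Fin 6 → ℂ) (p q : ℂ) : ℂ := ellipticBetaIntegral t p q / ellipticBetaProduct t p q

/-- The integral and the product satisfy the same relation with the same theta factors, which cancel
because |p| < |x₀x_j| < 1 keeps those containing x₀ nonzero. -/
theorem ellipticBetaRatio_base_shift {x : Fin 6 → ℂ} {p q : ℂ} (hp : ‖p‖ < 1) (hq : ‖q‖ < 1)
    (hp0 : p ≠ 0) (hq0 : q ≠ 0) (hx : ∀ j, ‖x j‖ < 1) (hprod : ∏ j, x j = p) :
    ellipticBetaRatio ![q * x 0, x 1, x 2, x 3, x 4, x 5] p q =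
      ellipticBetaRatio ![x 0, q * x 1, x 2, x 3, x 4, x 5] p q := by
  have hx0 : ∀ j, x j ≠ 0 := fun j =>
    Finset.prod_ne_zero_iff.1 (hprod ▸ hp0) j (Finset.mem_univ j)
  have hqx : ∀ j, ‖q * x j‖ < 1 := fun j => by
    rw [norm_mul]; exact mul_lt_one_of_nonneg_of_lt_one_left (norm_nonneg _) hq (hx j).le
  have hI := ellipticBetaIntegral_base_shift hp hq hp0 hq0 hx hprod
  have hN := ellipticBetaProduct_base_shift hp hq hq0 hx0 hx
  have n1 : ellipticBetaProduct ![q * x 0, x 1, x 2, x 3, x 4, x 5] p q ≠ 0 := by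
    refine IsBetaParam.ellipticBetaProduct_ne_zero ⟨fun j => ?_, ?_⟩ hp0 hq0 hp hq
    · fin_cases j <;> first | exact hqx 0 | apply hx
    · rw [← hprod, Fin.prod_univ_six, Fin.prod_univ_six]; simp; ring
  have n2 : ellipticBetaProduct ![x 0, q * x 1, x 2, x 3, x 4, x 5] p q ≠ 0 := by
    refine IsBetaParam.ellipticBetaProduct_ne_zero ⟨fun j => ?_, ?_⟩ hp0 hq0 hp hq
    · fin_cases j <;> first | exact hqx 1 | apply hx
    · rw [← hprod, Fin.prod_univ_six, Fin.prod_univ_six]; simp; ring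
  have hθ : ∀ j : Fin 6, j ≠ 0 → qTheta (x 0 * x j) p ≠ 0 := fun j hj => by
    obtain ⟨l, hl0, hlj⟩ := exists_ne_ne_fin_six 0 j
    refine qTheta_ne_zero hp ?_ ?_
    · rw [← hprod]
      exact norm_prod_lt_norm_mul hx0 hx hj.symm hl0 hlj
    · rw [norm_mul]
      exact mul_lt_one_of_nonneg_of_lt_one_left (norm_nonneg _) (hx 0) (hx j).le
  have hΘ0 := mul_ne_zero (mul_ne_zero (mul_ne_zero (hθ 2 (by decide)) (hθ 3 (by decide)))
    (hθ 4 (by decide))) (hθ 5 (by decide))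
  unfold ellipticBetaRatio
  rw [div_eq_div_iff n1 n2]
  apply mul_left_cancel₀ hΘ0
  set Θ0 := qTheta (x 0 * x 2) p * qTheta (x 0 * x 3) p * qTheta (x 0 * x 4) p *
          qTheta (x 0 * x 5) p
  linear_combination ellipticBetaProduct ![q * x 0, x 1, x 2, x 3, x 4, x 5] p q * hI -
    ellipticBetaIntegral ![q * x 0, x 1, x 2, x 3, x 4, x 5] p q * hN

/-! ### Holomorphic dependence on the parameters. -/

theorem differentiableOn_intervalIntegral_of_continuousOn {U : Set ℂ} (hU : IsOpen U)
    {H : ℂ → ℝ → ℂ} {a b : ℝ}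
    (hc : ContinuousOn (fun x : ℂ × ℝ => H x.1 x.2) (U ×ˢ Set.univ))
    (hd : ∀ θ, DifferentiableOn ℂ (fun w => H w θ) U) :
    DifferentiableOn ℂ (fun w => ∫ θ in a..b, H w θ) U := by
  intro w₀ hw₀
  obtain ⟨r, hr, hrU⟩ : ∃ r > 0, Metric.closedBall w₀ (r + r) ⊆ U := by
    obtain ⟨ε, hε, h⟩ := Metric.isOpen_iff.1 hU w₀ hw₀
    exact ⟨ε / 4, by positivity, (Metric.closedBall_subset_ball (by linarith)).trans h⟩
  have hball : ∀ w ∈ Metric.ball w₀ r, Metric.closedBall w r ⊆ Metric.closedBall w₀ (r + r) := by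
    intro w hw
    apply Metric.closedBall_subset_closedBall'
    have := Metric.mem_ball.1 hw
    linarith
  have hcont : ∀ w ∈ U, Continuous (H w) := fun w hw =>
    hc.comp_continuous (f := fun θ : ℝ => (w, θ)) (by fun_prop) fun θ => ⟨hw, Set.mem_univ _⟩
  obtain ⟨M, hM⟩ := ((isCompact_closedBall w₀ (r + r)).prod
    (isCompact_uIcc (a := a) (b := b))).exists_bound_of_continuousOn
      (hc.mono (Set.prod_mono hrU (Set.subset_univ _)))
  have hder : ∀ θ, ∀ w ∈ Metric.ball w₀ r, DifferentiableAt ℂ (fun w => H w θ) w := fun θ w hw =>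
    (hd θ).differentiableAt (hU.mem_nhds (hrU (hball w hw (Metric.mem_closedBall_self hr.le))))
  have hwU : ∀ w ∈ Metric.ball w₀ r, w ∈ U := fun w hw =>
    hrU (hball w hw (Metric.mem_closedBall_self hr.le))
  have hw₀r : w₀ ∈ Metric.ball w₀ r := Metric.mem_ball_self hr
  have key := intervalIntegral.hasDerivAt_integral_of_dominated_loc_of_deriv_le
    (μ := MeasureTheory.volume) (F := H) (a := a) (b := b)
    (F' := fun w θ => deriv (fun w => H w θ) w) (x₀ := w₀)
    (s := Metric.ball w₀ r) (bound := fun _ => M / r) (Metric.ball_mem_nhds w₀ hr)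
    (by filter_upwards [hU.mem_nhds hw₀] with w hw using (hcont w hw).aestronglyMeasurable)
    ((hcont w₀ hw₀).intervalIntegrable a b) ?_ ?_ intervalIntegrable_const ?_
  · exact key.2.differentiableAt.differentiableWithinAt
  · have hlim : ∀ θ, Tendsto (fun n : ℕ => ((r / 2 / (n + 1) : ℝ) : ℂ)⁻¹ *
        (H (w₀ + (r / 2 / (n + 1) : ℝ)) θ - H w₀ θ)) atTop (𝓝 (deriv (fun w => H w θ) w₀)) := by
      intro θ
      have h1 := (hder θ w₀ hw₀r).hasDerivAt.tendsto_slope_zero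
      have h2 : Tendsto (fun n : ℕ => ((r / 2 / (n + 1) : ℝ) : ℂ)) atTop (𝓝[≠] 0) := by
        refine tendsto_nhdsWithin_iff.2 ⟨?_, .of_forall fun n => ?_⟩
        · have : Tendsto (fun n : ℕ => (r / 2 / (n + 1) : ℝ)) atTop (𝓝 0) := by
            simpa [mul_div_assoc, div_eq_mul_inv] using
              (tendsto_one_div_add_atTop_nhds_zero_nat (𝕜 := ℝ)).const_mul (r / 2)
          exact (continuous_ofReal.tendsto' 0 0 ofReal_zero).comp this
        · have : (r / 2 / (n + 1) : ℝ) ≠ 0 := by positivity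
          exact ofReal_ne_zero.2 this
      exact h1.comp h2
    refine aestronglyMeasurable_of_tendsto_ae atTop (fun n => ?_) (.of_forall hlim)
    have hmem : w₀ + ((r / 2 / (n + 1) : ℝ) : ℂ) ∈ U := by
      apply hwU
      rw [Metric.mem_ball, dist_eq_norm, add_sub_cancel_left, norm_real, Real.norm_eq_abs,
        abs_of_pos (by positivity)]
      calc r / 2 / (n + 1) ≤ r / 2 := div_le_self (by positivity) (by linarith [n.cast_nonneg (α := ℝ)])
        _ < r := by linarith
    exact (continuous_const.mul ((hcont _ hmem).sub (hcont w₀ hw₀))).aestronglyMeasurable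
  -- Cauchy's estimate on circles of radius r bounds the derivative by M / r uniformly.
  · refine .of_forall fun θ hθ w hw => ?_
    refine norm_deriv_le_of_forall_mem_sphere_norm_le hr ?_ fun z hz => ?_
    · refine DifferentiableOn.diffContOnCl ?_
      rw [closure_ball _ hr.ne']
      exact (hd θ).mono ((hball w hw).trans hrU)
    · exact hM (z, θ) ⟨hball w hw (Metric.sphere_subset_closedBall hz), Set.uIoc_subset_uIcc hθ⟩
  · exact .of_forall fun θ _ w hw => (hder θ w hw).hasDerivAt

theorem differentiableOn_circleIntegral_of_continuousOn {U : Set ℂ} (hU : IsOpen U)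
    {F : ℂ → ℂ → ℂ}
    (hc : ContinuousOn (fun x : ℂ × ℂ => F x.1 x.2) (U ×ˢ Metric.sphere 0 1))
    (hd : ∀ z ∈ Metric.sphere (0 : ℂ) 1, DifferentiableOn ℂ (fun w => F w z) U) :
    DifferentiableOn ℂ (fun w => ∮ z in C(0, 1), F w z) U := by
  unfold circleIntegral
  have hs : ∀ θ : ℝ, circleMap 0 1 θ ∈ Metric.sphere (0 : ℂ) 1 := fun θ =>
    circleMap_mem_sphere 0 zero_le_one θ
  refine differentiableOn_intervalIntegral_of_continuousOn hU ?_ fun θ => ?_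
  · simp only [deriv_circleMap, smul_eq_mul]
    refine ContinuousOn.mul (by fun_prop) ?_
    exact hc.comp (f := fun x : ℂ × ℝ => (x.1, circleMap 0 1 x.2)) (by fun_prop)
      fun x hx => ⟨hx.1, hs _⟩
  · simp only [smul_eq_mul]
    exact (hd _ (hs θ)).const_mul _

theorem differentiableOn_ellipticBetaRatio {U : Set ℂ} (hU : IsOpen U) {t : ℂ → Fin 6 → ℂ}
    {p q : ℂ} (hp : ‖p‖ < 1) (hq : ‖q‖ < 1) (hp0 : p ≠ 0) (hq0 : q ≠ 0)
    (ht : ∀ j, DifferentiableOn ℂ (fun w => t w j) U) (hD : ∀ w ∈ U, IsBetaParam (t w) p q) :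
    DifferentiableOn ℂ (fun w => ellipticBetaRatio (t w) p q) U := by
  have hg : ∀ {f : ℂ → ℂ}, DifferentiableOn ℂ f U → (∀ w ∈ U, f w ≠ 0) → (∀ w ∈ U, ‖f w‖ < 1) →
      DifferentiableOn ℂ (fun w => ellipticGamma (f w) p q) U := fun {f} hf hf0 hf1 w hw =>
    (differentiableAt_ellipticGamma hp hq (hf0 w hw) (hf1 w hw)).comp_differentiableWithinAt
      w (hf w hw)
  refine DifferentiableOn.div ?_ ?_ fun w hw =>
    (hD w hw).ellipticBetaProduct_ne_zero hp0 hq0 hp hq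
  · refine differentiableOn_circleIntegral_of_continuousOn hU ?_ fun z hz => ?_
    · have hs : ∀ x ∈ U ×ˢ Metric.sphere (0 : ℂ) 1, ‖x.2‖ = 1 := fun x hx => by simpa using hx.2
      refine ContinuousOn.mul ?_ ?_
      · exact continuousOn_snd.inv₀ fun x hx h => by simpa [h] using hs x hx
      · refine continuousOn_regularBetaDensity hp hq (t := fun x : ℂ × ℂ => t x.1)
          (continuousOn_pi.2 fun j => ?_) continuousOn_snd (fun x hx => (hD _ hx.1).ne_zero hp0 hq0)
          (fun x hx => (hD _ hx.1).norm_lt_one) hs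
        exact (ht j).continuousOn.comp continuousOn_fst fun x hx => hx.1
    · have hz1 : ‖z‖ = 1 := by simpa using hz
      have hz0 : z ≠ 0 := fun h => by simp [h] at hz1
      unfold regularBetaDensity
      refine DifferentiableOn.const_mul (DifferentiableOn.const_mul
        (DifferentiableOn.fun_finsetProd fun j _ => DifferentiableOn.mul ?_ ?_) _) _
      · refine hg ((ht j).mul_const _) (fun w hw => mul_ne_zero ((hD w hw).ne_zero hp0 hq0 j) hz0)
          fun w hw => ?_
        rw [norm_mul, hz1, mul_one]
        exact (hD w hw).norm_lt_one j
      · refine hg ((ht j).mul_const _)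
          (fun w hw => mul_ne_zero ((hD w hw).ne_zero hp0 hq0 j) (inv_ne_zero hz0)) fun w hw => ?_
        rw [norm_mul, norm_inv, hz1, inv_one, mul_one]
        exact (hD w hw).norm_lt_one j
  · refine DifferentiableOn.fun_finsetProd fun j _ => DifferentiableOn.fun_finsetProd fun k _ => ?_
    refine hg ((ht j).mul (ht k))
      (fun w hw => mul_ne_zero ((hD w hw).ne_zero hp0 hq0 j) ((hD w hw).ne_zero hp0 hq0 k))
      fun w hw => ?_
    rw [norm_mul]
    exact mul_lt_one_of_nonneg_of_lt_one_left (norm_nonneg _) ((hD w hw).norm_lt_one j)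
      ((hD w hw).norm_lt_one k).le

/-! ### The ratio depends on a pair only through its product. -/

/-- A holomorphic function on a sufficiently wide annulus that is invariant under `z ↦ q z` is
constant. -/
theorem eq_of_mul_invariant_on_annulus {F : ℂ → ℂ} {q : ℂ} {c : ℝ} (hc0 : 0 < c) (hcq : c < ‖q‖)
    (hq : ‖q‖ < 1) (hF : ∀ z, c < ‖z‖ → ‖z‖ < 1 → DifferentiableAt ℂ F z)
    (hinv : ∀ z, ‖z‖ < 1 → c < ‖q * z‖ → F (q * z) = F z) {x y : ℂ}
    (hx : c < ‖x‖) (hx1 : ‖x‖ < 1) (hy : c < ‖y‖) (hy1 : ‖y‖ < 1) : F x = F y := by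
  have hqpos : 0 < ‖q‖ := hc0.trans hcq
  have hq0 : q ≠ 0 := norm_pos_iff.1 hqpos
  have hcq1 : c / ‖q‖ < 1 := (div_lt_one hqpos).2 hcq
  have hccq : c < c / ‖q‖ := (lt_div_iff₀ hqpos).2 (mul_lt_of_lt_one_right hc0 hq)
  -- The radii a ≤ b are such that every z in the open annulus has z, z/q or qz in the compact
  -- annulus a ≤ |z| ≤ b. Hence |F| attains its supremum.
  obtain ⟨b, hb, hb1⟩ := exists_between (max_lt hq hcq1)
  obtain ⟨hqb, hcb⟩ := max_lt_iff.1 hb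
  have hb0 : 0 < b := hqpos.trans hqb
  obtain ⟨a, ha⟩ : ∃ a, a = min (c / ‖q‖) (‖q‖ * b) := ⟨_, rfl⟩
  have hac : a ≤ c / ‖q‖ := ha ▸ min_le_left _ _
  have haq : a ≤ ‖q‖ * b := ha ▸ min_le_right _ _
  have hca : c < a := by
    rw [ha]
    exact lt_min hccq (by rwa [div_lt_iff₀' hqpos] at hcb)
  have hab : a ≤ b := haq.trans (mul_le_of_le_one_left hb0.le hq.le)
  let K : Set ℂ := Metric.closedBall 0 b ∩ {z | a ≤ ‖z‖}
  have hK : IsCompact K := (isCompact_closedBall 0 b).inter_right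
    (isClosed_le continuous_const continuous_norm)
  have hKmem : ∀ z, z ∈ K ↔ ‖z‖ ≤ b ∧ a ≤ ‖z‖ := fun z => by simp [K]
  have hKne : K.Nonempty := ⟨(b : ℂ), (hKmem _).2 (by simp [abs_of_pos hb0, hab])⟩
  obtain ⟨z₀, hz₀, hmax⟩ := hK.exists_isMaxOn hKne (f := fun z => ‖F z‖) fun z hz =>
    (hF z (hca.trans_le ((hKmem z).1 hz).2)
      (((hKmem z).1 hz).1.trans_lt hb1)).continuousAt.norm.continuousWithinAt
  have hmax' : ∀ z, c < ‖z‖ → ‖z‖ < 1 → ‖F z‖ ≤ ‖F z₀‖ := by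
    intro z hz hz1
    rcases lt_or_ge ‖z‖ a with h | h
    · have h1 : q * (z / q) = z := by field_simp
      have h2 : ‖z / q‖ ≤ b := by
        rw [norm_div, div_le_iff₀' hqpos]; exact h.le.trans haq
      have h3 : a ≤ ‖z / q‖ := by
        rw [norm_div]; exact hac.trans (by gcongr)
      have h4 := hinv (z / q) (h2.trans_lt hb1) (by rwa [h1])
      rw [h1] at h4
      rw [h4]
      exact hmax ((hKmem _).2 ⟨h2, h3⟩)
    rcases lt_or_ge b ‖z‖ with h' | h'
    · have h2 : ‖q * z‖ ≤ b := by
        rw [norm_mul]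
        exact (mul_le_of_le_one_right hqpos.le hz1.le).trans hqb.le
      have h3 : a ≤ ‖q * z‖ := by
        rw [norm_mul]; exact haq.trans (by gcongr)
      rw [← hinv z hz1 (hca.trans_le h3)]
      exact hmax ((hKmem _).2 ⟨h2, h3⟩)
    · exact hmax ((hKmem _).2 ⟨h', h⟩)
  -- Pulling back by exp replaces the annulus by a strip, which is convex and hence connected, as
  -- the maximum principle requires.
  let S : Set ℂ := {u | Real.log c < u.re} ∩ {u | u.re < 0}
  have hSmem : ∀ u, u ∈ S ↔ c < ‖exp u‖ ∧ ‖exp u‖ < 1 := by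
    intro u
    rw [norm_exp, Real.exp_lt_one_iff, ← Real.log_lt_iff_lt_exp hc0]
    rfl
  have hSo : IsOpen S := (isOpen_lt continuous_const continuous_re).inter
    (isOpen_lt continuous_re continuous_const)
  have hSc : IsPreconnected S :=
    ((convex_halfSpace_re_gt _).inter (convex_halfSpace_re_lt _)).isPreconnected
  have hS : ∀ z, c < ‖z‖ → ‖z‖ < 1 → exp (log z) = z ∧ log z ∈ S := by
    intro z hz hz1
    have : exp (log z) = z := exp_log (norm_pos_iff.1 (hc0.trans hz))
    exact ⟨this, (hSmem _).2 (by rw [this]; exact ⟨hz, hz1⟩)⟩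
  obtain ⟨e0, h0⟩ := hS z₀ (hca.trans_le ((hKmem _).1 hz₀).2) (((hKmem _).1 hz₀).1.trans_lt hb1)
  have hconst := Complex.eqOn_of_isPreconnected_of_isMaxOn_norm (f := fun u => F (exp u)) hSc hSo
    (fun u hu => ((hF _ ((hSmem u).1 hu).1 ((hSmem u).1 hu).2).comp u
      differentiableAt_exp).differentiableWithinAt) h0
    (fun u hu => by
      simpa [e0] using hmax' _ ((hSmem u).1 hu).1 ((hSmem u).1 hu).2)
  obtain ⟨ex, hxS⟩ := hS x hx hx1
  obtain ⟨ey, hyS⟩ := hS y hy hy1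
  have h1 := hconst hxS
  have h2 := hconst hyS
  simp only [Function.const, ex, ey] at h1 h2
  rw [h1, h2]

theorem isBetaParam_vec {x y a b c d p q : ℂ} :
    IsBetaParam ![x, y, a, b, c, d] p q ↔
      (‖x‖ < 1 ∧ ‖y‖ < 1 ∧ ‖a‖ < 1 ∧ ‖b‖ < 1 ∧ ‖c‖ < 1 ∧ ‖d‖ < 1) ∧
        x * y * (a * b * c * d) = p * q := by
  constructor
  · rintro ⟨h1, h2⟩
    refine ⟨⟨h1 0, h1 1, h1 2, h1 3, h1 4, h1 5⟩, ?_⟩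
    rw [← h2, Fin.prod_univ_six]
    simp
    ring
  · rintro ⟨⟨h0, h1, h2, h3, h4, h5⟩, h⟩
    refine ⟨fun j => by fin_cases j <;> assumption, ?_⟩
    rw [← h, Fin.prod_univ_six]
    simp
    ring

/-- With k = xy fixed, the ratio is holomorphic in the first parameter on |k| < |u| < 1 and
invariant under u ↦ qu. The condition |k| < |q| makes the annulus wider than one period. -/
theorem ellipticBetaRatio_eq_of_norm_mul_lt {x y x' y' a b c d p q : ℂ} (hp : ‖p‖ < 1)
    (hq : ‖q‖ < 1) (hp0 : p ≠ 0) (hq0 : q ≠ 0) (h : IsBetaParam ![x, y, a, b, c, d] p q)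
    (h' : IsBetaParam ![x', y', a, b, c, d] p q) (hxy : ‖x * y‖ < ‖q‖) :
    ellipticBetaRatio ![x, y, a, b, c, d] p q = ellipticBetaRatio ![x', y', a, b, c, d] p q := by
  obtain ⟨⟨hx, hy, ha, hb, hc, hd⟩, hprod⟩ := isBetaParam_vec.1 h
  obtain ⟨⟨hx', hy', -⟩, hprod'⟩ := isBetaParam_vec.1 h'
  have hx0 : x ≠ 0 := h.ne_zero hp0 hq0 0
  have hy0 : y ≠ 0 := h.ne_zero hp0 hq0 1
  have hx0' : x' ≠ 0 := h'.ne_zero hp0 hq0 0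
  have hk : x * y = x' * y' := by
    refine mul_right_cancel₀ (b := a * b * c * d) ?_ (hprod.trans hprod'.symm)
    intro h0
    rw [h0, mul_zero] at hprod
    exact mul_ne_zero hp0 hq0 hprod.symm
  obtain ⟨k, hkdef⟩ : ∃ k, k = x * y := ⟨_, rfl⟩
  have hk0 : k ≠ 0 := hkdef ▸ mul_ne_zero hx0 hy0
  have hy_eq : y = k / x := by rw [hkdef]; field_simp
  have hy_eq' : y' = k / x' := by rw [hkdef, hk]; field_simp
  rw [hy_eq, hy_eq']
  have hkn : 0 < ‖k‖ := norm_pos_iff.2 hk0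
  have hdom : ∀ u, ‖k‖ < ‖u‖ → ‖u‖ < 1 → IsBetaParam ![u, k / u, a, b, c, d] p q := by
    intro u hu hu1
    have hu0 : u ≠ 0 := norm_pos_iff.1 (hkn.trans hu)
    refine isBetaParam_vec.2 ⟨⟨hu1, ?_, ha, hb, hc, hd⟩, ?_⟩
    · rwa [norm_div, div_lt_one (hkn.trans hu)]
    · rw [← hprod, hkdef]; field_simp
  refine eq_of_mul_invariant_on_annulus (F := fun u => ellipticBetaRatio ![u, k / u, a, b, c, d] p q)
    (q := q) (c := ‖k‖) hkn (hkdef ▸ hxy) hq ?_ ?_ ?_ hx ?_ hx'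
  · intro u hu hu1
    have hopen : IsOpen ({u : ℂ | ‖k‖ < ‖u‖} ∩ {u | ‖u‖ < 1}) :=
      (isOpen_lt continuous_const continuous_norm).inter
        (isOpen_lt continuous_norm continuous_const)
    refine (differentiableOn_ellipticBetaRatio hopen (t := fun u => ![u, k / u, a, b, c, d]) hp hq
      hp0 hq0 (fun j => ?_) fun w hw => hdom w hw.1 hw.2).differentiableAt (hopen.mem_nhds ⟨hu, hu1⟩)
    have hne : ∀ w ∈ ({u : ℂ | ‖k‖ < ‖u‖} ∩ {u | ‖u‖ < 1}), w ≠ 0 := fun w hw =>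
      norm_pos_iff.1 (hkn.trans hw.1)
    fin_cases j
    · exact differentiableOn_id
    · exact (differentiableOn_const k).div differentiableOn_id hne
    all_goals exact differentiableOn_const _
  · intro u hu hu1
    have hqu : q * u ≠ 0 := norm_pos_iff.1 (hkn.trans hu1)
    have hu0 : u ≠ 0 := right_ne_zero_of_mul hqu
    -- The product of these six numbers is p, and moving the factor q from the first to the second
    -- exchanges (qu, k/(qu)) with (u, k/u).
    have key := ellipticBetaRatio_base_shift (x := ![u, k / (q * u), a, b, c, d]) hp hq hp0 hq0
      (fun j => ?_) ?_
    · simp only [Matrix.cons_val] at key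
      rwa [show q * (k / (q * u)) = k / u by field_simp] at key
    · have hlt : ‖k / (q * u)‖ < 1 := by rwa [norm_div, div_lt_one (hkn.trans hu1)]
      fin_cases j <;> assumption
    · apply mul_right_cancel₀ hq0
      rw [← hprod, Fin.prod_univ_six, mul_assoc x, ← mul_assoc x, ← hkdef]
      simp only [Matrix.cons_val]
      field_simp
  · rw [hkdef, norm_mul]
    exact mul_lt_of_lt_one_right (norm_pos_iff.2 hx0) hy
  · rw [hkdef, hk, norm_mul]
    exact mul_lt_of_lt_one_right (norm_pos_iff.2 hx0') hy'

/-- Analytic continuation removes the condition |xy| < |q|: a, b, c, d are deformed to their powers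
of exponent w, with the compensating factor put on x and x'. At w = 1 the parameters are the given
ones, and as w → 0 the product of the pair tends to pq, of norm below |q|. -/
theorem ellipticBetaRatio_eq_of_pair {x y x' y' a b c d p q : ℂ} (hp : ‖p‖ < 1)
    (hq : ‖q‖ < 1) (hp0 : p ≠ 0) (hq0 : q ≠ 0) (h : IsBetaParam ![x, y, a, b, c, d] p q)
    (h' : IsBetaParam ![x', y', a, b, c, d] p q) :
    ellipticBetaRatio ![x, y, a, b, c, d] p q = ellipticBetaRatio ![x', y', a, b, c, d] p q := by
  obtain ⟨⟨hx, hy, ha, hb, hc, hd⟩, hprod⟩ := isBetaParam_vec.1 h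
  obtain ⟨⟨hx', hy', -⟩, hprod'⟩ := isBetaParam_vec.1 h'
  have logneg : ∀ {u : ℂ}, u ≠ 0 → ‖u‖ < 1 → (log u).re < 0 := fun hu0 hu => by
    rw [log_re]; exact Real.log_neg (norm_pos_iff.2 hu0) hu
  have ha0 : a ≠ 0 := h.ne_zero hp0 hq0 2
  have hb0 : b ≠ 0 := h.ne_zero hp0 hq0 3
  have hc0 : c ≠ 0 := h.ne_zero hp0 hq0 4
  have hd0 : d ≠ 0 := h.ne_zero hp0 hq0 5
  have hx0 : x ≠ 0 := h.ne_zero hp0 hq0 0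
  have hx0' : x' ≠ 0 := h'.ne_zero hp0 hq0 0
  have la := logneg ha0 ha
  have lb := logneg hb0 hb
  have lc := logneg hc0 hc
  have ld := logneg hd0 hd
  have lx := logneg hx0 hx
  have lx' := logneg hx0' hx'
  obtain ⟨L, hL⟩ : ∃ L, L = log a + log b + log c + log d := ⟨_, rfl⟩
  have hLre : L.re < 0 := by rw [hL]; simp only [add_re]; linarith
  have hexpL : exp L = a * b * c * d := by
    rw [hL, exp_add, exp_add, exp_add, exp_log ha0, exp_log hb0, exp_log hc0, exp_log hd0]
  let T : ℂ → ℂ → ℂ → Fin 6 → ℂ := fun x y w => ![x * exp ((1 - w) * L), y, exp (w * log a),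
    exp (w * log b), exp (w * log c), exp (w * log d)]
  have hT1 : ∀ x y, T x y 1 = ![x, y, a, b, c, d] := by
    intro x y
    simp [T, exp_log ha0, exp_log hb0, exp_log hc0, exp_log hd0]
  -- Each condition says that one deformed parameter has norm below 1. Each defines a half-plane in
  -- w, so `W` is convex; it contains (0, 1].
  let W : Set ℂ := ((({w | (w * log a).re < 0} ∩ {w | (w * log b).re < 0}) ∩
    ({w | (w * log c).re < 0} ∩ {w | (w * log d).re < 0})) ∩
    ({w | L.re + (log x).re < (w * L).re} ∩ {w | L.re + (log x').re < (w * L).re}))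
  have lin : ∀ u : ℂ, IsLinearMap ℝ fun w : ℂ => (w * u).re := fun u =>
    ⟨fun v w => by simp [add_mul], fun r w => by simp; ring⟩
  have cont : ∀ u : ℂ, Continuous fun w : ℂ => (w * u).re := fun u => by fun_prop
  have hWo : IsOpen W :=
    (((isOpen_lt (cont _) continuous_const).inter (isOpen_lt (cont _) continuous_const)).inter
    ((isOpen_lt (cont _) continuous_const).inter (isOpen_lt (cont _) continuous_const))).inter
    ((isOpen_lt continuous_const (cont _)).inter (isOpen_lt continuous_const (cont _)))
  have hWc : IsPreconnected W := Convex.isPreconnected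
    ((((convex_halfSpace_lt (lin _) _).inter (convex_halfSpace_lt (lin _) _)).inter
    ((convex_halfSpace_lt (lin _) _).inter (convex_halfSpace_lt (lin _) _))).inter
    ((convex_halfSpace_gt (lin _) _).inter (convex_halfSpace_gt (lin _) _)))
  have hnorm : ∀ {z : ℂ}, z ≠ 0 → ∀ {w : ℂ}, L.re + (log z).re < (w * L).re →
      ‖z * exp ((1 - w) * L)‖ < 1 := by
    intro z hz w hw
    conv_lhs => rw [← exp_log hz]
    rw [← exp_add, norm_exp, Real.exp_lt_one_iff, sub_mul, one_mul, add_re, sub_re]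
    linarith
  have hexp : ∀ {u w : ℂ}, (w * u).re < 0 → ‖exp (w * u)‖ < 1 := fun hw => by
    rwa [norm_exp, Real.exp_lt_one_iff]
  have hTprod : ∀ {x y : ℂ}, x * y * (a * b * c * d) = p * q → ∀ w,
      x * exp ((1 - w) * L) * y * (exp (w * log a) * exp (w * log b) * exp (w * log c) *
        exp (w * log d)) = p * q := by
    intro x y hxy w
    rw [← exp_add, ← exp_add, ← exp_add, ← hxy, ← hexpL,
      show w * log a + w * log b + w * log c + w * log d = w * L by rw [hL]; ring,
      show L = (1 - w) * L + w * L by ring, exp_add,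
      show (1 - w) * ((1 - w) * L + w * L) = (1 - w) * L by ring,
      show w * ((1 - w) * L + w * L) = w * L by ring]
    ring
  have hD : ∀ w ∈ W, IsBetaParam (T x y w) p q := fun w hw =>
    isBetaParam_vec.2 ⟨⟨hnorm hx0 hw.2.1, hy, hexp hw.1.1.1, hexp hw.1.1.2, hexp hw.1.2.1,
      hexp hw.1.2.2⟩, hTprod hprod w⟩
  have hD' : ∀ w ∈ W, IsBetaParam (T x' y' w) p q := fun w hw =>
    isBetaParam_vec.2 ⟨⟨hnorm hx0' hw.2.2, hy', hexp hw.1.1.1, hexp hw.1.1.2, hexp hw.1.2.1,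
      hexp hw.1.2.2⟩, hTprod hprod' w⟩
  have hTd : ∀ x y j, DifferentiableOn ℂ (fun w => T x y w j) W := by
    intro x y j
    apply Differentiable.differentiableOn
    fin_cases j <;> simp [T] <;> fun_prop
  have an := (differentiableOn_ellipticBetaRatio hWo hp hq hp0 hq0 (hTd x y) hD).analyticOnNhd hWo
  have an' := (differentiableOn_ellipticBetaRatio hWo hp hq hp0 hq0 (hTd x' y') hD').analyticOnNhd
    hWo
  have hW1 : ∀ ε : ℝ, 0 < ε → ε ≤ 1 → (ε : ℂ) ∈ W := by
    intro ε h0 h1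
    have key : ∀ u : ℂ, ((ε : ℂ) * u).re = ε * u.re := fun u => re_ofReal_mul ε u
    have hmul : L.re ≤ ε * L.re := by nlinarith
    simp only [W, Set.mem_inter_iff, Set.mem_ofPred_eq, key]
    refine ⟨⟨⟨?_, ?_⟩, ⟨?_, ?_⟩⟩, ⟨?_, ?_⟩⟩
    · exact mul_neg_of_pos_of_neg h0 la
    · exact mul_neg_of_pos_of_neg h0 lb
    · exact mul_neg_of_pos_of_neg h0 lc
    · exact mul_neg_of_pos_of_neg h0 ld
    · linarith
    · linarith
  have hVc : Continuous fun w : ℂ => ‖x * exp ((1 - w) * L) * y‖ := by fun_prop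
  have hV0 : ‖x * exp ((1 - 0) * L) * y‖ < ‖q‖ := by
    rw [sub_zero, one_mul, hexpL,
      show x * (a * b * c * d) * y = p * q by rw [← hprod]; ring, norm_mul]
    exact mul_lt_of_lt_one_left (norm_pos_iff.2 hq0) hp
  obtain ⟨ε, hε0, hε1, hεV⟩ : ∃ ε : ℝ, 0 < ε ∧ ε ≤ 1 ∧
      ‖x * exp ((1 - (ε : ℂ)) * L) * y‖ < ‖q‖ := by
    have hc : Continuous fun ε : ℝ => ‖x * exp ((1 - (ε : ℂ)) * L) * y‖ :=
      hVc.comp continuous_ofReal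
    have hev : ∀ᶠ ε : ℝ in 𝓝[>] 0, ‖x * exp ((1 - (ε : ℂ)) * L) * y‖ < ‖q‖ :=
      nhdsWithin_le_nhds (hc.continuousAt.eventually_lt continuousAt_const (by simpa using hV0))
    obtain ⟨ε, h1, h2⟩ := (hev.and (Ioc_mem_nhdsGT zero_lt_one)).exists
    exact ⟨ε, h2.1, h2.2, h1⟩
  -- Near a small ε the pair has product of norm below |q|, so the restricted case applies; the
  -- identity theorem carries the equality to w = 1.
  have hev : (fun w => ellipticBetaRatio (T x y w) p q) =ᶠ[𝓝 (ε : ℂ)]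
      fun w => ellipticBetaRatio (T x' y' w) p q := by
    filter_upwards [hWo.mem_nhds (hW1 ε hε0 hε1),
      hVc.continuousAt.eventually_lt continuousAt_const hεV] with w hw hwV
    exact ellipticBetaRatio_eq_of_norm_mul_lt hp hq hp0 hq0 (hD w hw) (hD' w hw) hwV
  have := an.eqOn_of_preconnected_of_eventuallyEq an' hWc (hW1 ε hε0 hε1) hev
    (by simpa using hW1 1 one_pos le_rfl)
  simpa only [hT1] using this

/-! ### Reduction to two equal parameters. -/

/-- Integral and product are both symmetric. This transposition and the exchange of pairs below
suffice to bring first t₀, t₂ and then t₁, t₃ into the two slots on which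
`ellipticBetaRatio_eq_of_pair` acts. -/
theorem ellipticBetaRatio_swap (t₀ t₁ t₂ t₃ t₄ t₅ p q : ℂ) :
    ellipticBetaRatio ![t₀, t₁, t₂, t₃, t₄, t₅] p q =
      ellipticBetaRatio ![t₀, t₂, t₁, t₃, t₄, t₅] p q := by
  have h1 : ellipticBetaIntegral ![t₀, t₁, t₂, t₃, t₄, t₅] p q =
      ellipticBetaIntegral ![t₀, t₂, t₁, t₃, t₄, t₅] p q := by
    unfold ellipticBetaIntegral
    congr 1
    ext z
    simp only [regularBetaDensity, Fin.prod_univ_six, Matrix.cons_val]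
    ring
  have h2 : ellipticBetaProduct ![t₀, t₁, t₂, t₃, t₄, t₅] p q =
      ellipticBetaProduct ![t₀, t₂, t₁, t₃, t₄, t₅] p q := by
    simp only [ellipticBetaProduct_eq, Matrix.cons_val, mul_comm t₂ t₁]
    ring
  rw [ellipticBetaRatio, ellipticBetaRatio, h1, h2]

theorem ellipticBetaRatio_swap_pairs (t₀ t₁ t₂ t₃ t₄ t₅ p q : ℂ) :
    ellipticBetaRatio ![t₀, t₁, t₂, t₃, t₄, t₅] p q =
      ellipticBetaRatio ![t₂, t₃, t₀, t₁, t₄, t₅] p q := by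
  have h1 : ellipticBetaIntegral ![t₀, t₁, t₂, t₃, t₄, t₅] p q =
      ellipticBetaIntegral ![t₂, t₃, t₀, t₁, t₄, t₅] p q := by
    unfold ellipticBetaIntegral
    congr 1
    ext z
    simp only [regularBetaDensity, Fin.prod_univ_six, Matrix.cons_val]
    ring
  have h2 : ellipticBetaProduct ![t₀, t₁, t₂, t₃, t₄, t₅] p q =
      ellipticBetaProduct ![t₂, t₃, t₀, t₁, t₄, t₅] p q := by
    simp only [ellipticBetaProduct_eq, Matrix.cons_val, mul_comm t₂ t₀, mul_comm t₂ t₁,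
      mul_comm t₃ t₀, mul_comm t₃ t₁]
    ring
  rw [ellipticBetaRatio, ellipticBetaRatio, h1, h2]

/-- Two parameters can be moved to a common value `τ` close to one without changing the ratio. -/
theorem ellipticBetaRatio_eq_of_lt {t : Fin 6 → ℂ} {p q τ : ℂ} (hp : ‖p‖ < 1)
    (hq : ‖q‖ < 1) (hp0 : p ≠ 0) (hq0 : q ≠ 0) (h : IsBetaParam t p q) (hτ : ‖τ‖ < 1)
    (h02 : ‖t 0 * t 2‖ < ‖τ‖) (h13 : ‖t 1 * t 3‖ < ‖τ‖) :
    ellipticBetaRatio t p q =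
      ellipticBetaRatio ![τ, t 1 * t 3 / τ, τ, t 0 * t 2 / τ, t 4, t 5] p q := by
  have ht : t = ![t 0, t 1, t 2, t 3, t 4, t 5] := by
    ext j; fin_cases j <;> rfl
  have hτ0 : τ ≠ 0 := norm_pos_iff.1 ((norm_nonneg _).trans_lt h02)
  have l02 : ‖t 0 * t 2 / τ‖ < 1 := by rwa [norm_div, div_lt_one (norm_pos_iff.2 hτ0)]
  have l13 : ‖t 1 * t 3 / τ‖ < 1 := by rwa [norm_div, div_lt_one (norm_pos_iff.2 hτ0)]
  have hn := h.norm_lt_one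
  have hP := h.prod_eq
  rw [Fin.prod_univ_six] at hP
  conv_lhs => rw [ht, ellipticBetaRatio_swap]
  rw [ellipticBetaRatio_eq_of_pair (x' := τ) (y' := t 0 * t 2 / τ) hp hq hp0 hq0,
    ellipticBetaRatio_swap_pairs,
    ellipticBetaRatio_eq_of_pair (x' := τ) (y' := t 1 * t 3 / τ) hp hq hp0 hq0]
  · refine isBetaParam_vec.2 ⟨⟨hn 1, hn 3, hτ, l02, hn 4, hn 5⟩, ?_⟩
    rw [← hP]; field_simp
  · refine isBetaParam_vec.2 ⟨⟨hτ, l13, hτ, l02, hn 4, hn 5⟩, ?_⟩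
    rw [← hP]; field_simp
  · refine isBetaParam_vec.2 ⟨⟨hn 0, hn 2, hn 1, hn 3, hn 4, hn 5⟩, ?_⟩
    rw [← hP]; ring
  · refine isBetaParam_vec.2 ⟨⟨hτ, l02, hn 1, hn 3, hn 4, hn 5⟩, ?_⟩
    rw [← hP]; field_simp

/-! ### An approximate identity at z = 1. -/

/-- The kernel `(1 - τ²)(1 - z²)(1 - z⁻²) / ((1 - τz)(1 - τ/z))²`. -/
noncomputable def betaKernel (τ : ℝ) (z : ℂ) : ℂ :=
  (1 - τ ^ 2) * ((1 - z ^ 2) * (1 - (z ^ 2)⁻¹)) / ((1 - τ * z) * (1 - τ * z⁻¹)) ^ 2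

theorem one_sub_ofReal_mul_ne_zero {τ : ℝ} (h0 : 0 ≤ τ) (h1 : τ < 1) {z : ℂ} (hz : ‖z‖ ≤ 1) :
    1 - τ * z ≠ 0 := by
  intro h
  have h2 : ‖(τ : ℂ) * z‖ < 1 := by
    rw [norm_mul, norm_real, Real.norm_eq_abs, abs_of_nonneg h0]
    exact mul_lt_one_of_nonneg_of_lt_one_left h0 h1 hz
  rw [← sub_eq_zero.1 h] at h2
  simp at h2

/-- On the unit circle z⁻¹ is the conjugate of z. The kernel is therefore real and nonnegative for 0
≤ τ < 1, so its L¹ norm is read off from its integral. -/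
theorem betaKernel_eq {τ : ℝ} {z : ℂ} (hz : ‖z‖ = 1) :
    betaKernel τ z = (((1 - τ ^ 2) * ‖1 - z ^ 2‖ ^ 2 / ‖1 - τ * z‖ ^ 4 : ℝ) : ℂ) := by
  have hinv : z⁻¹ = (starRingEnd ℂ) z := by rw [inv_def, normSq_eq_norm_sq, hz]; simp
  have e1 : ((‖1 - z ^ 2‖ ^ 2 : ℝ) : ℂ) = (1 - z ^ 2) * (1 - (z ^ 2)⁻¹) := by
    rw [ofReal_pow, ← mul_conj', ← inv_pow, hinv]; simp
  have e2 : ((‖1 - τ * z‖ ^ 2 : ℝ) : ℂ) = (1 - τ * z) * (1 - τ * z⁻¹) := by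
    rw [ofReal_pow, ← mul_conj', hinv]; simp
  rw [betaKernel, ← e1, ← e2]
  push_cast
  ring

theorem norm_betaKernel_eq {τ : ℝ} (h0 : 0 ≤ τ) (h1 : τ < 1) {z : ℂ} (hz : ‖z‖ = 1) :
    ‖betaKernel τ z‖ = (1 - τ ^ 2) * ‖1 - z ^ 2‖ ^ 2 / ‖1 - τ * z‖ ^ 4 := by
  rw [betaKernel_eq hz, norm_real, Real.norm_eq_abs, abs_of_nonneg]
  have : 0 ≤ 1 - τ ^ 2 := by nlinarith
  positivity

/-- From |1 - z²| ≤ 2|1 - z| and |1 - τz| ≥ |1 - z|/2; the constant is 2² · 2⁴. Away from z = 1 the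
kernel thus tends uniformly to 0. -/
theorem norm_betaKernel_le {τ : ℝ} (h0 : 0 ≤ τ) (h1 : τ < 1) {z : ℂ} (hz : ‖z‖ = 1)
    (hz1 : z ≠ 1) : ‖betaKernel τ z‖ ≤ 64 * (1 - τ ^ 2) / ‖1 - z‖ ^ 2 := by
  have hpos : 0 < ‖1 - z‖ := norm_pos_iff.2 (sub_ne_zero.2 hz1.symm)
  have hτ : 0 ≤ 1 - τ ^ 2 := by nlinarith
  have a1 : ‖1 - z ^ 2‖ ≤ 2 * ‖1 - z‖ := by
    rw [show 1 - z ^ 2 = (1 + z) * (1 - z) by ring, norm_mul]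
    gcongr
    calc ‖1 + z‖ ≤ ‖(1 : ℂ)‖ + ‖z‖ := norm_add_le _ _
      _ = 2 := by rw [hz, norm_one]; norm_num
  have a2 : 1 - τ ≤ ‖1 - τ * z‖ := by
    have := norm_sub_norm_le (1 : ℂ) (τ * z)
    rwa [norm_one, norm_mul, hz, norm_real, Real.norm_eq_abs, abs_of_nonneg h0, mul_one] at this
  have a3 : ‖1 - z‖ ≤ ‖1 - τ * z‖ + (1 - τ) := by
    calc ‖1 - z‖ = ‖(1 - τ * z) - ((1 - τ : ℝ) : ℂ) * z‖ := by push_cast; ring_nf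
      _ ≤ ‖1 - τ * z‖ + ‖((1 - τ : ℝ) : ℂ) * z‖ := norm_sub_le _ _
      _ = _ := by
        rw [norm_mul, hz, mul_one, norm_real, Real.norm_eq_abs, abs_of_nonneg (by linarith)]
  have a4 : ‖1 - z‖ / 2 ≤ ‖1 - τ * z‖ := by linarith
  rw [norm_betaKernel_eq h0 h1 hz]
  calc (1 - τ ^ 2) * ‖1 - z ^ 2‖ ^ 2 / ‖1 - τ * z‖ ^ 4
      ≤ (1 - τ ^ 2) * (2 * ‖1 - z‖) ^ 2 / (‖1 - z‖ / 2) ^ 4 := by gcongr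
    _ = 64 * (1 - τ ^ 2) / ‖1 - z‖ ^ 2 := by field_simp; ring

theorem continuousOn_betaKernel {τ : ℝ} (h0 : 0 ≤ τ) (h1 : τ < 1) :
    ContinuousOn (betaKernel τ) (Metric.sphere 0 1) := by
  intro z hz
  have hz1 : ‖z‖ = 1 := by simpa using hz
  have hz0 : z ≠ 0 := fun h => by simp [h] at hz1
  have n1 := one_sub_ofReal_mul_ne_zero h0 h1 hz1.le
  have n2 := one_sub_ofReal_mul_ne_zero h0 h1 (z := z⁻¹) (by rw [norm_inv, hz1, inv_one])
  unfold betaKernel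
  refine ContinuousAt.continuousWithinAt (ContinuousAt.div ?_ ?_ (pow_ne_zero 2 (mul_ne_zero n1 n2)))
  · fun_prop (disch := positivity)
  · fun_prop (disch := assumption)

/-- In the disc the integrand has a simple pole at 0 and a double pole at τ. Writing it as (1 -
τ²)/τ² times Φ(z)/(z - τ)² - 1/z with Φ holomorphic, Cauchy's formula gives 2πi (1 - τ²)/τ² (Φ'(τ) -
1), where Φ'(τ) = (1 + τ²)/(1 - τ²). -/
theorem circleIntegral_betaKernel {τ : ℝ} (h0 : 0 < τ) (h1 : τ < 1) :
    (∮ z in C(0, 1), z⁻¹ * betaKernel τ z) = 4 * Real.pi * I := by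
  have hτ0 : (τ : ℂ) ≠ 0 := ofReal_ne_zero.2 h0.ne'
  have hτ1 : 1 - (τ : ℂ) ^ 2 ≠ 0 := by
    have := one_sub_ofReal_mul_ne_zero h0.le h1 (z := τ)
      (by rw [norm_real, Real.norm_eq_abs, abs_of_pos h0]; exact h1.le)
    rwa [pow_two]
  let U : Set ℂ := {z | 1 - τ * z ≠ 0}
  have hU : IsOpen U := isOpen_ne_fun (by fun_prop) continuous_const
  let Φ : ℂ → ℂ := fun z => -(1 - (τ : ℂ) ^ 2) ^ 2 * (z / (1 - τ * z) ^ 2) +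
    2 * (1 + (τ : ℂ) ^ 2) * ((z - τ) / (1 - τ * z))
  have hΦ : ∀ z : ℂ, 1 - τ * z ≠ 0 → HasDerivAt Φ
      (-(1 - (τ : ℂ) ^ 2) ^ 2 * ((1 + τ * z) / (1 - τ * z) ^ 3) +
        2 * (1 + (τ : ℂ) ^ 2) * ((1 - (τ : ℂ) ^ 2) / (1 - τ * z) ^ 2)) z := by
    intro z hz
    have l : HasDerivAt (fun z : ℂ => 1 - τ * z) (-τ) z := by
      simpa using ((hasDerivAt_id z).const_mul (τ : ℂ)).const_sub 1
    have d1 := ((hasDerivAt_id z).div (l.pow 2) (pow_ne_zero 2 hz)).const_mul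
      (-(1 - (τ : ℂ) ^ 2) ^ 2)
    have d2 := (((hasDerivAt_id z).sub_const (τ : ℂ)).div l hz).const_mul (2 * (1 + (τ : ℂ) ^ 2))
    refine (d1.add d2).congr_deriv ?_
    simp
    field_simp
    ring
  have hball : Metric.closedBall (0 : ℂ) 1 ⊆ U := fun z hz =>
    one_sub_ofReal_mul_ne_zero h0.le h1 (by simpa using hz)
  have hτb : (τ : ℂ) ∈ Metric.ball (0 : ℂ) 1 := by simpa [abs_of_pos h0] using h1
  have hΦd : DifferentiableOn ℂ Φ U := fun z hz => (hΦ z hz).differentiableAt.differentiableWithinAt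
  have C := two_pi_I_inv_smul_circleIntegral_sub_sq_inv_smul_of_differentiable hU hball hΦd hτb
  rw [(hΦ τ (hball (Metric.ball_subset_closedBall hτb))).deriv] at C
  have C0 : (∮ z in C(0, 1), z⁻¹) = 2 * Real.pi * I := by
    simpa using circleIntegral.integral_sub_center_inv (0 : ℂ) one_ne_zero
  have hs : ∀ z ∈ Metric.sphere (0 : ℂ) 1, z ≠ 0 ∧ z - τ ≠ 0 ∧ 1 - τ * z ≠ 0 := by
    intro z hz
    have hz1 : ‖z‖ = 1 := by simpa using hz
    refine ⟨fun h => by simp [h] at hz1, fun h => ?_, one_sub_ofReal_mul_ne_zero h0.le h1 hz1.le⟩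
    rw [sub_eq_zero.1 h, norm_real, Real.norm_eq_abs, abs_of_pos h0] at hz1
    exact h1.ne hz1
  have hpt : ∀ z ∈ Metric.sphere (0 : ℂ) 1, z⁻¹ * betaKernel τ z =
      (1 - (τ : ℂ) ^ 2) / (τ : ℂ) ^ 2 * (((z - τ) ^ 2)⁻¹ • Φ z - z⁻¹) := by
    intro z hz
    obtain ⟨hz0, n1, n2⟩ := hs z hz
    have n3 : 1 - τ * z⁻¹ = (z - τ) / z := by field_simp
    simp only [betaKernel, Φ, n3, smul_eq_mul]
    obtain ⟨w, hw⟩ : ∃ w, w = 1 - τ * z := ⟨_, rfl⟩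
    rw [← hw] at n2 ⊢
    field_simp
    rw [hw]
    ring
  rw [circleIntegral.integral_congr zero_le_one hpt, circleIntegral.integral_const_mul,
    circleIntegral.integral_sub, C0]
  · rw [inv_smul_eq_iff₀ two_pi_I_ne_zero] at C
    rw [C, smul_eq_mul, ← pow_two]
    field_simp
    ring
  · refine ContinuousOn.circleIntegrable zero_le_one fun z hz => ?_
    obtain ⟨hz0, n1, n2⟩ := hs z hz
    refine ContinuousWithinAt.fun_smul (ContinuousAt.continuousWithinAt ?_)
      (hΦ z n2).continuousAt.continuousWithinAt
    fun_prop (disch := positivity)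
  · exact ContinuousOn.circleIntegrable zero_le_one
      (continuousOn_id.inv₀ fun z hz => (hs z hz).1)

/-- As `τ → 1`, the kernel concentrates at `z = 1`. -/
theorem tendsto_circleIntegral_betaKernel {h : ℝ → ℂ → ℂ} {τ₀ : ℝ} (hτ₀ : 0 < τ₀) (hτ₁ : τ₀ < 1)
    (hc : ContinuousOn (fun x : ℝ × ℂ => h x.1 x.2) (Set.Icc τ₀ 1 ×ˢ Metric.sphere 0 1)) :
    Tendsto (fun τ => ∮ z in C(0, 1), z⁻¹ * (betaKernel τ z * h τ z)) (𝓝[<] 1)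
      (𝓝 (4 * Real.pi * I * h 1 1)) := by
  have hmem1 : ((1 : ℝ), (1 : ℂ)) ∈ Set.Icc τ₀ 1 ×ˢ Metric.sphere (0 : ℂ) 1 :=
    ⟨⟨hτ₁.le, le_rfl⟩, by simp⟩
  obtain ⟨M, hM⟩ := (isCompact_Icc.prod (isCompact_sphere (0 : ℂ) 1)).exists_bound_of_continuousOn hc
  have hM0 : 0 ≤ M := (norm_nonneg _).trans (hM _ hmem1)
  rw [Metric.tendsto_nhds]
  intro ε hε
  obtain ⟨η, hη, hηε⟩ : ∃ η > 0, η * (4 * Real.pi) < ε / 2 :=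
    ⟨ε / (16 * Real.pi), by positivity, by field_simp; norm_num⟩
  obtain ⟨δ, hδ, hδη⟩ := Metric.continuousWithinAt_iff.1 (hc _ hmem1) η hη
  have hlim : Tendsto (fun τ : ℝ => 2 * Real.pi * (128 * M * (1 - τ ^ 2) / δ ^ 2)) (𝓝[<] 1)
      (𝓝 0) := by
    have : Continuous fun τ : ℝ => 2 * Real.pi * (128 * M * (1 - τ ^ 2) / δ ^ 2) := by fun_prop
    exact (this.tendsto' 1 0 (by simp)).mono_left nhdsWithin_le_nhds
  have hnear : ∀ᶠ τ : ℝ in 𝓝[<] 1, max τ₀ (1 - δ) < τ ∧ τ < 1 :=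
    Ioo_mem_nhdsLT (max_lt hτ₁ (by linarith))
  filter_upwards [hnear, hlim.eventually_lt_const (half_pos hε)] with τ hτ hsmall
  obtain ⟨hτ', hτ1⟩ := hτ
  obtain ⟨hτ0, hτδ⟩ := max_lt_iff.1 hτ'
  have hpos : 0 < τ := hτ₀.trans hτ0
  have hsph : ∀ θ : ℝ, circleMap 0 1 θ ∈ Metric.sphere (0 : ℂ) 1 := fun θ =>
    circleMap_mem_sphere 0 zero_le_one θ
  have hn1 : ∀ z ∈ Metric.sphere (0 : ℂ) 1, ‖z‖ = 1 := fun z hz => by simpa using hz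
  have hz0 : ∀ z ∈ Metric.sphere (0 : ℂ) 1, z ≠ 0 := fun z hz h => by
    have := hn1 z hz; simp [h] at this
  -- Within δ of z = 1 the oscillation of h is below η; elsewhere the kernel is at most 64(1 -
  -- τ²)/δ² and the oscillation at most 2M.
  have hpt : ∀ z ∈ Metric.sphere (0 : ℂ) 1, ‖betaKernel τ z * (h τ z - h 1 1)‖ ≤
      η * ‖betaKernel τ z‖ + 128 * M * (1 - τ ^ 2) / δ ^ 2 := by
    intro z hz
    have hτ2 : 0 ≤ 1 - τ ^ 2 := by nlinarith
    have hin : (τ, z) ∈ Set.Icc τ₀ 1 ×ˢ Metric.sphere (0 : ℂ) 1 := ⟨⟨hτ0.le, hτ1.le⟩, hz⟩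
    rw [norm_mul]
    rcases lt_or_ge (dist z 1) δ with hzd | hzd
    · have := hδη hin (by
        rw [Prod.dist_eq]
        refine max_lt ?_ hzd
        rw [Real.dist_eq, abs_sub_lt_iff]
        constructor <;> linarith)
      rw [dist_eq_norm] at this
      calc ‖betaKernel τ z‖ * ‖h τ z - h 1 1‖ ≤ ‖betaKernel τ z‖ * η := by gcongr
        _ ≤ _ := by rw [mul_comm]; exact le_add_of_nonneg_right (by positivity)
    · have hzd' : δ ≤ ‖1 - z‖ := by rwa [dist_eq_norm, norm_sub_rev] at hzd
      have hz1 : z ≠ 1 := fun h => by simp [h] at hzd; linarith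
      have b1 : ‖betaKernel τ z‖ ≤ 64 * (1 - τ ^ 2) / δ ^ 2 :=
        (norm_betaKernel_le hpos.le hτ1 (hn1 z hz) hz1).trans (by gcongr)
      have b2 : ‖h τ z - h 1 1‖ ≤ 2 * M := by
        calc _ ≤ ‖h τ z‖ + ‖h 1 1‖ := norm_sub_le _ _
          _ ≤ M + M := add_le_add (hM _ hin) (hM _ hmem1)
          _ = 2 * M := by ring
      calc ‖betaKernel τ z‖ * ‖h τ z - h 1 1‖ ≤ 64 * (1 - τ ^ 2) / δ ^ 2 * (2 * M) := by gcongr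
        _ = 128 * M * (1 - τ ^ 2) / δ ^ 2 := by ring
        _ ≤ _ := le_add_of_nonneg_left (by positivity)
  have hKc := continuousOn_betaKernel hpos.le hτ1
  have hhc : ContinuousOn (h τ) (Metric.sphere 0 1) :=
    hc.comp (f := fun z : ℂ => (τ, z)) (by fun_prop) fun z hz => ⟨⟨hτ0.le, hτ1.le⟩, hz⟩
  have hinvc : ContinuousOn (fun z : ℂ => z⁻¹) (Metric.sphere 0 1) := continuousOn_id.inv₀ hz0
  have hKθ : Continuous fun θ : ℝ => betaKernel τ (circleMap 0 1 θ) :=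
    hKc.comp_continuous (by fun_prop) hsph
  -- By positivity the L¹ norm is the same for all τ, so the contribution near z = 1 is at most 4πη.
  have mass : ∫ θ in (0 : ℝ)..2 * Real.pi, ‖betaKernel τ (circleMap 0 1 θ)‖ = 4 * Real.pi := by
    have := circleIntegral_betaKernel hpos hτ1
    unfold circleIntegral at this
    have e : ∀ θ : ℝ, deriv (circleMap 0 1) θ • ((circleMap 0 1 θ)⁻¹ *
        betaKernel τ (circleMap 0 1 θ)) = I * (‖betaKernel τ (circleMap 0 1 θ)‖ : ℝ) := by
      intro θ
      have hθ := hz0 _ (hsph θ)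
      rw [norm_betaKernel_eq hpos.le hτ1 (hn1 _ (hsph θ)), ← betaKernel_eq (hn1 _ (hsph θ)),
        deriv_circleMap, smul_eq_mul]
      field_simp
    simp only [e] at this
    rw [intervalIntegral.integral_const_mul, intervalIntegral.integral_ofReal] at this
    have h2 : (((∫ θ in (0 : ℝ)..2 * Real.pi, ‖betaKernel τ (circleMap 0 1 θ)‖) : ℝ) : ℂ) =
        ((4 * Real.pi : ℝ) : ℂ) := by
      apply mul_left_cancel₀ I_ne_zero
      rw [this]; push_cast; ring
    exact_mod_cast h2
  rw [dist_eq_norm]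
  have hdiff : (∮ z in C(0, 1), z⁻¹ * (betaKernel τ z * h τ z)) - 4 * Real.pi * I * h 1 1 =
      ∮ z in C(0, 1), z⁻¹ * (betaKernel τ z * (h τ z - h 1 1)) := by
    rw [← circleIntegral_betaKernel hpos hτ1, mul_comm _ (h 1 1),
      ← circleIntegral.integral_const_mul, ← circleIntegral.integral_sub]
    · congr 1; ext z; ring
    · exact (hinvc.mul (hKc.mul hhc)).circleIntegrable zero_le_one
    · exact (continuousOn_const.mul (hinvc.mul hKc)).circleIntegrable zero_le_one
  rw [hdiff, circleIntegral]
  have hgi : IntervalIntegrable (fun θ : ℝ => η * ‖betaKernel τ (circleMap 0 1 θ)‖)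
      MeasureTheory.volume 0 (2 * Real.pi) := (continuous_const.mul hKθ.norm).intervalIntegrable _ _
  have hle := intervalIntegral.norm_integral_le_of_norm_le (μ := MeasureTheory.volume)
    (f := fun θ : ℝ => deriv (circleMap 0 1) θ • ((circleMap 0 1 θ)⁻¹ *
      (betaKernel τ (circleMap 0 1 θ) * (h τ (circleMap 0 1 θ) - h 1 1))))
    (g := fun θ : ℝ => η * ‖betaKernel τ (circleMap 0 1 θ)‖ + 128 * M * (1 - τ ^ 2) / δ ^ 2)
    Real.two_pi_pos.le (.of_forall fun θ _ => by
      refine le_trans (le_of_eq ?_) (hpt _ (hsph θ))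
      rw [norm_smul, norm_mul (circleMap 0 1 θ)⁻¹, norm_inv, hn1 _ (hsph θ), deriv_circleMap,
        norm_mul, hn1 _ (hsph θ), norm_I]
      simp)
    (hgi.add intervalIntegrable_const)
  refine hle.trans_lt ?_
  rw [intervalIntegral.integral_add hgi intervalIntegrable_const,
    intervalIntegral.integral_const_mul, mass, intervalIntegral.integral_const, sub_zero,
    smul_eq_mul]
  linarith

/-! ### The limit τ → 1. -/

/-- The function `(1 - z) Γ(z; p, q)`, without the singularity at `z = 1`. -/
noncomputable def ellipticGammaReg (z p q : ℂ) : ℂ :=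
  pqPochInf (p * q * z⁻¹) p q / (qPochInf (p * z) p * pqPochInf (q * z) p q)

theorem ellipticGamma_eq_reg_div {z p q : ℂ} (hp : ‖p‖ < 1) (hq : ‖q‖ < 1) :
    ellipticGamma z p q = ellipticGammaReg z p q / (1 - z) := by
  rw [ellipticGamma, ellipticGammaReg, pqPochInf_eq_mul z hp hq, qPochInf_eq_mul z hp, div_div]
  congr 1
  ring

theorem norm_mul_lt_one_of_le {y z : ℂ} (hy : ‖y‖ < 1) (hz : ‖z‖ ≤ 1) : ‖y * z‖ < 1 := by
  rw [norm_mul]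
  exact mul_lt_one_of_nonneg_of_lt_one_left (norm_nonneg _) hy hz

theorem continuousAt_ellipticGammaReg {z p q : ℂ} (hp : ‖p‖ < 1) (hq : ‖q‖ < 1)
    (hz0 : z ≠ 0) (hz : ‖z‖ ≤ 1) : ContinuousAt (fun z => ellipticGammaReg z p q) z := by
  have hP := (differentiable_pqPochInf hp hq).continuous
  have hQ := (differentiable_qPochInf hp).continuous
  unfold ellipticGammaReg
  refine ContinuousAt.div ?_ ?_ (mul_ne_zero (qPochInf_ne_zero hp (norm_mul_lt_one_of_le hp hz))
    (pqPochInf_ne_zero hp hq (norm_mul_lt_one_of_le hq hz)))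
  · exact hP.continuousAt.comp (f := fun z => p * q * z⁻¹) (by fun_prop (disch := assumption))
  · exact ((hQ.comp (continuous_const_mul p)).mul (hP.comp (continuous_const_mul q))).continuousAt

/-- The source of (p;p)_∞ (q;q)_∞ in κ. -/
theorem ellipticGammaReg_one {p q : ℂ} (hp : ‖p‖ < 1) (hq : ‖q‖ < 1) :
    ellipticGammaReg 1 p q = (qPochInf p p * qPochInf q q)⁻¹ := by
  have h := pqPochInf_ne_zero hp hq (norm_mul_lt_one_of_le hp hq.le)
  rw [ellipticGammaReg, inv_one, mul_one, mul_one, mul_one, pqPochInf_eq_mul' q hp hq]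
  generalize pqPochInf (p * q) p q = X at *
  field_simp

/-- The density at `![τ, A / τ, τ, B / τ, c, d]` without the factors singular at `τ = z = 1`. -/
noncomputable def betaCofactor (A B c d p q : ℂ) (τ : ℝ) (z : ℂ) : ℂ :=
  qPochInf (p * z ^ 2) p * qPochInf (p / z ^ 2) p *
    (qPochInf (q * (z ^ 2)⁻¹) q * qPochInf (q / (z ^ 2)⁻¹) q) *
    (ellipticGammaReg (τ * z) p q * ellipticGammaReg (τ * z⁻¹) p q) ^ 2 *
    ((ellipticGamma (A / τ * z) p q * ellipticGamma (A / τ * z⁻¹) p q) *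
      (ellipticGamma (B / τ * z) p q * ellipticGamma (B / τ * z⁻¹) p q) *
      (ellipticGamma (c * z) p q * ellipticGamma (c * z⁻¹) p q) *
      (ellipticGamma (d * z) p q * ellipticGamma (d * z⁻¹) p q))

/-- The two thetas supply (1 - z²)(1 - z⁻²), and the doubled parameter τ supplies the squared
denominator of the kernel. -/
theorem one_sub_sq_mul_regularBetaDensity {A B c d p q : ℂ} {τ : ℝ} {z : ℂ} (hp : ‖p‖ < 1)
    (hq : ‖q‖ < 1) :
    (1 - (τ : ℂ) ^ 2) * regularBetaDensity ![(τ : ℂ), A / τ, τ, B / τ, c, d] p q z =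
      betaKernel τ z * betaCofactor A B c d p q τ z := by
  have e1 : qTheta (z ^ 2) p = (1 - z ^ 2) * qPochInf (p * z ^ 2) p * qPochInf (p / z ^ 2) p := by
    rw [qTheta, qPochInf_eq_mul _ hp]
  have e2 : qTheta (z ^ 2)⁻¹ q =
      (1 - (z ^ 2)⁻¹) * qPochInf (q * (z ^ 2)⁻¹) q * qPochInf (q / (z ^ 2)⁻¹) q := by
    rw [qTheta, qPochInf_eq_mul _ hq]
  simp only [regularBetaDensity, betaKernel, betaCofactor, Fin.prod_univ_six, Matrix.cons_val, e1,
    e2, ellipticGamma_eq_reg_div (z := τ * z) hp hq, ellipticGamma_eq_reg_div (z := τ * z⁻¹) hp hq]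
  generalize 1 - (τ : ℂ) * z = u
  generalize 1 - (τ : ℂ) * z⁻¹ = v
  ring

theorem continuousOn_betaCofactor {A B c d p q : ℂ} {τ₀ : ℝ} (hp : ‖p‖ < 1) (hq : ‖q‖ < 1)
    (hA0 : A ≠ 0) (hB0 : B ≠ 0) (hc0 : c ≠ 0) (hd0 : d ≠ 0) (hτ₀ : 0 < τ₀) (hA : ‖A‖ < τ₀)
    (hB : ‖B‖ < τ₀) (hc : ‖c‖ < 1) (hd : ‖d‖ < 1) :
    ContinuousOn (fun x : ℝ × ℂ => betaCofactor A B c d p q x.1 x.2)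
      (Set.Icc τ₀ 1 ×ˢ Metric.sphere 0 1) := by
  rintro ⟨τ, z⟩ ⟨⟨hτ, hτ1⟩, hz⟩
  have hz1 : ‖z‖ = 1 := by simpa using hz
  have hz0 : z ≠ 0 := fun h => by simp [h] at hz1
  have hzi : ‖z⁻¹‖ = 1 := by rw [norm_inv, hz1, inv_one]
  dsimp only at hτ hτ1
  have hτ0 : 0 < τ := hτ₀.trans_le hτ
  have hτc : (τ : ℂ) ≠ 0 := ofReal_ne_zero.2 hτ0.ne'
  have hτn : ‖(τ : ℂ)‖ = τ := by rw [norm_real, Real.norm_eq_abs, abs_of_pos hτ0]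
  refine ContinuousAt.continuousWithinAt ?_
  have cp := (differentiable_qPochInf hp).continuous
  have cq := (differentiable_qPochInf hq).continuous
  have hreg : ∀ f : ℝ × ℂ → ℂ, ContinuousAt f (τ, z) → f (τ, z) ≠ 0 → ‖f (τ, z)‖ ≤ 1 →
      ContinuousAt (fun x => ellipticGammaReg (f x) p q) (τ, z) := fun f hf h0 h1 =>
    (continuousAt_ellipticGammaReg hp hq h0 h1).comp (f := f) hf
  have hgam : ∀ f : ℝ × ℂ → ℂ, ContinuousAt f (τ, z) → f (τ, z) ≠ 0 → ‖f (τ, z)‖ < 1 →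
      ContinuousAt (fun x => ellipticGamma (f x) p q) (τ, z) := fun f hf h0 h1 =>
    (differentiableAt_ellipticGamma hp hq h0 h1).continuousAt.comp (f := f) hf
  have hdiv : ∀ {s : ℂ}, ‖s‖ < τ₀ → ‖s / τ‖ < 1 := fun hs => by
    rw [norm_div, hτn, div_lt_one hτ0]; exact hs.trans_le hτ
  have hof : ContinuousAt (fun x : ℝ × ℂ => (x.1 : ℂ)) (τ, z) := by fun_prop
  have hsnd : ContinuousAt (fun x : ℝ × ℂ => x.2) (τ, z) := continuousAt_snd
  have hinv : ContinuousAt (fun x : ℝ × ℂ => x.2⁻¹) (τ, z) := hsnd.inv₀ hz0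
  have hsq : ContinuousAt (fun x : ℝ × ℂ => x.2 ^ 2) (τ, z) := hsnd.pow 2
  have hsqi : ContinuousAt (fun x : ℝ × ℂ => (x.2 ^ 2)⁻¹) (τ, z) := hsq.inv₀ (pow_ne_zero 2 hz0)
  have hpair : ∀ f : ℝ × ℂ → ℂ, ContinuousAt f (τ, z) → f (τ, z) ≠ 0 → ‖f (τ, z)‖ < 1 →
      ContinuousAt (fun x => ellipticGamma (f x * x.2) p q * ellipticGamma (f x * x.2⁻¹) p q)
        (τ, z) := fun f hf h0 h1 =>
    (hgam _ (hf.mul hsnd) (mul_ne_zero h0 hz0) (norm_mul_lt_one_of_le h1 hz1.le)).mul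
      (hgam _ (hf.mul hinv) (mul_ne_zero h0 (inv_ne_zero hz0)) (norm_mul_lt_one_of_le h1 hzi.le))
  unfold betaCofactor
  refine (((ContinuousAt.mul ?_ ?_).mul (ContinuousAt.mul ?_ ?_)).mul
    ((ContinuousAt.mul ?_ ?_).pow 2)).mul ((((hpair _ ?_ ?_ ?_).mul (hpair _ ?_ ?_ ?_)).mul
    (hpair _ continuousAt_const hc0 hc)).mul (hpair _ continuousAt_const hd0 hd))
  · exact cp.continuousAt.comp (continuousAt_const.mul hsq)
  · exact cp.continuousAt.comp (continuousAt_const.div hsq (pow_ne_zero 2 hz0))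
  · exact cq.continuousAt.comp (continuousAt_const.mul hsqi)
  · exact cq.continuousAt.comp (continuousAt_const.div hsqi (inv_ne_zero (pow_ne_zero 2 hz0)))
  · refine hreg _ (hof.mul hsnd) (mul_ne_zero hτc hz0) ?_
    change ‖(τ : ℂ) * z‖ ≤ 1
    rwa [norm_mul, hz1, mul_one, hτn]
  · refine hreg _ (hof.mul hinv) (mul_ne_zero hτc (inv_ne_zero hz0)) ?_
    change ‖(τ : ℂ) * z⁻¹‖ ≤ 1
    rwa [norm_mul, hzi, mul_one, hτn]
  · exact continuousAt_const.div hof hτc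
  · exact div_ne_zero hA0 hτc
  · exact hdiv hA
  · exact continuousAt_const.div hof hτc
  · exact div_ne_zero hB0 hτc
  · exact hdiv hB

/-- Only Γ(τ²) is singular, and 1 - τ² regularises it. In the limit each of A, B, c, d occurs twice,
while the six products of two of them cancel in pairs by reflection, since ABcd = pq. -/
theorem tendsto_one_sub_sq_mul_ellipticBetaProduct {A B c d p q : ℂ} (hp : ‖p‖ < 1) (hq : ‖q‖ < 1)
    (hp0 : p ≠ 0) (hq0 : q ≠ 0) (h : A * B * c * d = p * q)
    (hA : ‖A‖ < 1) (hB : ‖B‖ < 1) (hc : ‖c‖ < 1) (hd : ‖d‖ < 1) :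
    Tendsto (fun τ : ℝ => (1 - (τ : ℂ) ^ 2) *
        ellipticBetaProduct ![(τ : ℂ), A / τ, τ, B / τ, c, d] p q) (𝓝[<] 1)
      (𝓝 ((qPochInf p p * qPochInf q q)⁻¹ * (ellipticGamma A p q * ellipticGamma B p q *
        ellipticGamma c p q * ellipticGamma d p q) ^ 2)) := by
  have hpq := mul_ne_zero hp0 hq0
  rw [← h] at hpq
  have hd0 : d ≠ 0 := right_ne_zero_of_mul hpq
  have hc0 : c ≠ 0 := right_ne_zero_of_mul (left_ne_zero_of_mul hpq)
  have hB0 : B ≠ 0 := right_ne_zero_of_mul (left_ne_zero_of_mul (left_ne_zero_of_mul hpq))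
  have hA0 : A ≠ 0 := left_ne_zero_of_mul (left_ne_zero_of_mul (left_ne_zero_of_mul hpq))
  have G : ∀ (f : ℝ → ℂ) (s : ℂ), ContinuousAt f 1 → f 1 = s → s ≠ 0 → ‖s‖ < 1 →
      Tendsto (fun τ => ellipticGamma (f τ) p q) (𝓝[<] 1) (𝓝 (ellipticGamma s p q)) := by
    intro f s hf hs h0 h1
    have hf' : Tendsto f (𝓝[<] 1) (𝓝 s) := by
      rw [← hs]; exact hf.tendsto.mono_left nhdsWithin_le_nhds
    exact (differentiableAt_ellipticGamma hp hq h0 h1).continuousAt.tendsto.comp hf'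
  have hof : ContinuousAt (fun τ : ℝ => (τ : ℂ)) 1 := continuous_ofReal.continuousAt
  have hdv : ∀ s : ℂ, ContinuousAt (fun τ : ℝ => s / (τ : ℂ)) 1 := fun s =>
    continuousAt_const.div hof (by simp)
  have m := fun {y z : ℂ} (hy : ‖y‖ < 1) (hz : ‖z‖ < 1) => norm_mul_lt_one_of_le hy hz.le
  have R : Tendsto (fun τ : ℝ => ellipticGammaReg ((τ : ℂ) * τ) p q) (𝓝[<] 1)
      (𝓝 (qPochInf p p * qPochInf q q)⁻¹) := by
    rw [← ellipticGammaReg_one hp hq]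
    have h1 := continuousAt_ellipticGammaReg hp hq one_ne_zero (z := 1) (by simp)
    have h2 : Tendsto (fun τ : ℝ => (τ : ℂ) * τ) (𝓝[<] 1) (𝓝 1) := by
      have : Tendsto (fun τ : ℝ => (τ : ℂ) * τ) (𝓝[<] 1) (𝓝 (((1 : ℝ) : ℂ) * ((1 : ℝ) : ℂ))) :=
        (hof.mul hof).tendsto.mono_left nhdsWithin_le_nhds
      simpa only [ofReal_one, one_mul] using this
    exact h1.tendsto.comp h2
  have lim := (((((((((((((R.mul
    (G (fun τ => τ * (A / τ)) A (hof.mul (hdv A)) (by simp) hA0 hA)).mul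
    (G (fun τ => τ * (B / τ)) B (hof.mul (hdv B)) (by simp) hB0 hB)).mul
    (G (fun τ => τ * c) c (hof.mul continuousAt_const) (by simp) hc0 hc)).mul
    (G (fun τ => τ * d) d (hof.mul continuousAt_const) (by simp) hd0 hd)).mul
    (G (fun τ => A / τ * τ) A ((hdv A).mul hof) (by simp) hA0 hA)).mul
    (G (fun τ => A / τ * (B / τ)) (A * B) ((hdv A).mul (hdv B)) (by simp) (mul_ne_zero hA0 hB0)
      (m hA hB))).mul
    (G (fun τ => A / τ * c) (A * c) ((hdv A).mul continuousAt_const) (by simp)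
      (mul_ne_zero hA0 hc0) (m hA hc))).mul
    (G (fun τ => A / τ * d) (A * d) ((hdv A).mul continuousAt_const) (by simp)
      (mul_ne_zero hA0 hd0) (m hA hd))).mul
    (G (fun τ => τ * (B / τ)) B (hof.mul (hdv B)) (by simp) hB0 hB)).mul
    (G (fun τ => τ * c) c (hof.mul continuousAt_const) (by simp) hc0 hc)).mul
    (G (fun τ => τ * d) d (hof.mul continuousAt_const) (by simp) hd0 hd)).mul
    (G (fun τ => B / τ * c) (B * c) ((hdv B).mul continuousAt_const) (by simp)
      (mul_ne_zero hB0 hc0) (m hB hc))).mul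
    (G (fun τ => B / τ * d) (B * d) ((hdv B).mul continuousAt_const) (by simp)
      (mul_ne_zero hB0 hd0) (m hB hd))).mul
    (tendsto_const_nhds (x := ellipticGamma (c * d) p q))
  have r1 := ellipticGamma_mul_reflect hp hq (y := A * B) (z := c * d) (by rw [← h]; ring)
    (mul_ne_zero hA0 hB0) (mul_ne_zero hc0 hd0) (m hA hB) (m hc hd)
  have r2 := ellipticGamma_mul_reflect hp hq (y := A * c) (z := B * d) (by rw [← h]; ring)
    (mul_ne_zero hA0 hc0) (mul_ne_zero hB0 hd0) (m hA hc) (m hB hd)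
  have r3 := ellipticGamma_mul_reflect hp hq (y := A * d) (z := B * c) (by rw [← h]; ring)
    (mul_ne_zero hA0 hd0) (mul_ne_zero hB0 hc0) (m hA hd) (m hB hc)
  have hval : (qPochInf p p * qPochInf q q)⁻¹ * (ellipticGamma A p q * ellipticGamma B p q *
      ellipticGamma c p q * ellipticGamma d p q) ^ 2 = (qPochInf p p * qPochInf q q)⁻¹ *
      ellipticGamma A p q * ellipticGamma B p q * ellipticGamma c p q * ellipticGamma d p q *
      ellipticGamma A p q * ellipticGamma (A * B) p q * ellipticGamma (A * c) p q *
      ellipticGamma (A * d) p q * ellipticGamma B p q * ellipticGamma c p q * ellipticGamma d p q *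
      ellipticGamma (B * c) p q * ellipticGamma (B * d) p q * ellipticGamma (c * d) p q := by
    calc _ = (qPochInf p p * qPochInf q q)⁻¹ * (ellipticGamma A p q * ellipticGamma B p q *
        ellipticGamma c p q * ellipticGamma d p q) ^ 2 *
        ((ellipticGamma (A * B) p q * ellipticGamma (c * d) p q) *
        (ellipticGamma (A * c) p q * ellipticGamma (B * d) p q) *
        (ellipticGamma (A * d) p q * ellipticGamma (B * c) p q)) := by
          rw [r1, r2, r3]; ring
      _ = _ := by ring
  rw [hval]
  refine lim.congr' ?_
  · filter_upwards [Ioo_mem_nhdsLT (zero_lt_one' ℝ)] with τ hτ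
    have hτ1 : 1 - (τ : ℂ) * τ ≠ 0 := one_sub_ofReal_mul_ne_zero hτ.1.le hτ.2
      (by rw [norm_real, Real.norm_eq_abs, abs_of_pos hτ.1]; exact hτ.2.le)
    have hR : ellipticGammaReg ((τ : ℂ) * τ) p q =
        (1 - (τ : ℂ) * τ) * ellipticGamma ((τ : ℂ) * τ) p q := by
      rw [ellipticGamma_eq_reg_div hp hq, mul_div_cancel₀ _ hτ1]
    simp only [ellipticBetaProduct_eq, Matrix.cons_val, hR]
    ring

/-! ### The value of the constant, and the theorem. -/

theorem ellipticBetaKappa_mul_ratio {t : Fin 6 → ℂ} {p q : ℂ} (hp0 : p ≠ 0) (hq0 : q ≠ 0)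
    (hp : ‖p‖ < 1) (hq : ‖q‖ < 1) (h : IsBetaParam t p q) :
    ellipticBetaKappa p q * ellipticBetaRatio t p q = 1 := by
  have hn := h.norm_lt_one
  have h0 := h.ne_zero hp0 hq0
  have hP := h.prod_eq
  rw [Fin.prod_univ_six] at hP
  obtain ⟨A, hAdef⟩ : ∃ A, A = t 1 * t 3 := ⟨_, rfl⟩
  obtain ⟨B, hBdef⟩ : ∃ B, B = t 0 * t 2 := ⟨_, rfl⟩
  have hA : ‖A‖ < 1 := hAdef ▸ norm_mul_lt_one_of_le (hn 1) (hn 3).le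
  have hB : ‖B‖ < 1 := hBdef ▸ norm_mul_lt_one_of_le (hn 0) (hn 2).le
  have hA0 : A ≠ 0 := hAdef ▸ mul_ne_zero (h0 1) (h0 3)
  have hB0 : B ≠ 0 := hBdef ▸ mul_ne_zero (h0 0) (h0 2)
  have hprod : A * B * t 4 * t 5 = p * q := by rw [hAdef, hBdef, ← hP]; ring
  -- A τ₀ above ‖A‖ and ‖B‖ keeps A/τ and B/τ in the unit disc for all τ in [τ₀, 1].
  obtain ⟨τ₀, hτ, hτ₁⟩ := exists_between (max_lt hA hB)
  obtain ⟨hAτ, hBτ⟩ := max_lt_iff.1 hτ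
  have hτ₀ : 0 < τ₀ := (norm_nonneg _).trans_lt hAτ
  have L1 := tendsto_circleIntegral_betaKernel hτ₀ hτ₁
    (continuousOn_betaCofactor hp hq hA0 hB0 (h0 4) (h0 5) hτ₀ hAτ hBτ (hn 4) (hn 5))
  have L2 := tendsto_one_sub_sq_mul_ellipticBetaProduct hp hq hp0 hq0 hprod hA hB (hn 4) (hn 5)
  have hg : ∀ s ∈ ({A, B, t 4, t 5} : Set ℂ), ellipticGamma s p q ≠ 0 := by
    have key : ∀ s r, s * r = p * q → ‖r‖ < 1 → ‖s‖ < 1 → ellipticGamma s p q ≠ 0 := by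
      intro s r hsr hr hs
      have hs0 : s ≠ 0 := left_ne_zero_of_mul (hsr ▸ mul_ne_zero hp0 hq0)
      refine ellipticGamma_ne_zero hp hq hs ?_
      rw [← hsr, norm_mul]
      exact mul_lt_of_lt_one_right (norm_pos_iff.2 hs0) hr
    have m := fun {y z : ℂ} (hy : ‖y‖ < 1) (hz : ‖z‖ < 1) => norm_mul_lt_one_of_le hy hz.le
    rintro s (rfl | rfl | rfl | rfl)
    · exact key _ (B * t 4 * t 5) (by rw [← hprod]; ring) (m (m hB (hn 4)) (hn 5)) hA
    · exact key _ (A * t 4 * t 5) (by rw [← hprod]; ring) (m (m hA (hn 4)) (hn 5)) hB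
    · exact key _ (A * B * t 5) (by rw [← hprod]; ring) (m (m hA hB) (hn 5)) (hn 4)
    · exact key _ (A * B * t 4) (by rw [← hprod]; ring) (m (m hA hB) (hn 4)) (hn 5)
  have hQ : qPochInf p p * qPochInf q q ≠ 0 :=
    mul_ne_zero (qPochInf_ne_zero hp hp) (qPochInf_ne_zero hq hq)
  have hne : (qPochInf p p * qPochInf q q)⁻¹ * (ellipticGamma A p q * ellipticGamma B p q *
      ellipticGamma (t 4) p q * ellipticGamma (t 5) p q) ^ 2 ≠ 0 :=
    mul_ne_zero (inv_ne_zero hQ) (pow_ne_zero 2 (mul_ne_zero (mul_ne_zero (mul_ne_zero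
      (hg _ (by simp)) (hg _ (by simp))) (hg _ (by simp))) (hg _ (by simp))))
  have L3 := L1.div L2 hne
  have L4 : Tendsto (fun _ : ℝ => ellipticBetaRatio t p q) (𝓝[<] 1)
      (𝓝 (ellipticBetaRatio t p q)) := tendsto_const_nhds
  -- For τ in (τ₀, 1) the quotient of the two regularised sides equals the ratio at `t`, which does
  -- not depend on τ; so the quotient of the limits is that ratio.
  have huniq := tendsto_nhds_unique (L3.congr' ?_) L4
  · rw [← huniq, ellipticBetaKappa, betaCofactor]
    simp only [ofReal_one, one_pow, mul_one, div_one, inv_one, ellipticGammaReg_one hp hq]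
    have hpi : (Real.pi : ℂ) ≠ 0 := ofReal_ne_zero.2 Real.pi_ne_zero
    have hQp := qPochInf_ne_zero hp hp
    have hQq := qPochInf_ne_zero hq hq
    have gA := hg A (by simp)
    have gB := hg B (by simp)
    have gc := hg (t 4) (by simp)
    have gd := hg (t 5) (by simp)
    field_simp
  · filter_upwards [Ioo_mem_nhdsLT hτ₁] with τ hτ'
    have hpos : 0 < τ := hτ₀.trans hτ'.1
    have hτn : ‖(τ : ℂ)‖ = τ := by rw [norm_real, Real.norm_eq_abs, abs_of_pos hpos]
    have hτ1 : 1 - (τ : ℂ) ^ 2 ≠ 0 := by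
      have := one_sub_ofReal_mul_ne_zero hpos.le hτ'.2 (z := τ) (by rw [hτn]; exact hτ'.2.le)
      rwa [pow_two]
    rw [ellipticBetaRatio_eq_of_lt (τ := τ) hp hq hp0 hq0 h (by rw [hτn]; exact hτ'.2)
      (by rw [hτn, ← hBdef]; exact hBτ.trans hτ'.1) (by rw [hτn, ← hAdef]; exact hAτ.trans hτ'.1),
      ← hAdef, ← hBdef, ellipticBetaRatio]
    have e : (∮ z in C(0, 1), z⁻¹ * (betaKernel τ z * betaCofactor A B (t 4) (t 5) p q τ z)) =
        (1 - (τ : ℂ) ^ 2) *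
          ellipticBetaIntegral ![(τ : ℂ), A / τ, τ, B / τ, t 4, t 5] p q := by
      rw [ellipticBetaIntegral, ← circleIntegral.integral_const_mul]
      congr 1
      ext z
      rw [← one_sub_sq_mul_regularBetaDensity hp hq]
      ring
    simp only [Pi.div_apply]
    rw [e, mul_div_mul_left _ _ hτ1]

theorem mainTheorem1 (p q : ℂ) (t : Fin 6 → ℂ)
    (hp0 : p ≠ 0) (hq0 : q ≠ 0) (hp : ‖p‖ < 1) (hq : ‖q‖ < 1)
    (ht : ∀ j, ‖t j‖ < 1) (hbal : ∏ j, t j = p * q) :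
    CircleIntegrable (fun z : ℂ => ellipticBetaDensity t p q z / z) 0 1 ∧
    ellipticBetaKappa p q * (∮ z in C(0, 1), ellipticBetaDensity t p q z / z) =
      ∏ j : Fin 6, ∏ k ∈ Finset.Ioi j, ellipticGamma (t j * t k) p q := by
  have h : IsBetaParam t p q := ⟨ht, hbal⟩
  have hpt : ∀ z ∈ Metric.sphere (0 : ℂ) 1,
      ellipticBetaDensity t p q z / z = z⁻¹ * regularBetaDensity t p q z := fun z hz => by
    rw [ellipticBetaDensity_eq_regular hp hq (by simpa using hz), div_eq_inv_mul]
  constructor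
  · have := circleIntegrable_regularBetaDensity hp hq (h.ne_zero hp0 hq0) ht
    unfold CircleIntegrable at this ⊢
    refine this.congr fun θ _ => ?_
    exact (hpt _ (circleMap_mem_sphere 0 zero_le_one θ)).symm
  · rw [circleIntegral.integral_congr zero_le_one hpt]
    have h1 := ellipticBetaKappa_mul_ratio hp0 hq0 hp hq h
    rw [ellipticBetaRatio, ← mul_div_assoc,
      div_eq_one_iff_eq (h.ellipticBetaProduct_ne_zero hp0 hq0 hp hq)] at h1
    exact h1
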